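/- Let $\mathcal C$ be an abelian category with a symmetric monoidal structure $(\otimes,\phi_0,\psi_0,\mathbf 1_0)$ such that $\otimes$ is additive and exact in each variable (for instance a $\Bbbk$-linear tensor category with exact $\otimes$, over a field $\Bbbk$ of characteristic $0$). The *prolongation* $\mathbb D(\mathcal C)$ is the category whose objects $A$ are the exact sequences $0\to A_0\xrightarrow{i_A}A_1\xrightarrow{\pi_A}A_0\to0$ of $\mathcal C$ and whose morphisms are the morphisms of exact sequences with equal components at the two copies of $A_0$; put $\Pi_0(A)=A_0$. The *Yoneda sum* $A\star B$ of two objects over the same $X_0$ is $0\to X_0\to W\to X_0\to0$, where $W$ is the quotient of $A_1\times_{X_0}B_1$ by the image of $(i_A,-i_B)\colon X_0\to A_1\times_{X_0}B_1$; the map $X_0\to W$ is $x\mapsto[(i_Ax,0)]=[(0,i_Bx)]$, and $W\to X_0$ is $[(a,b)]\mapsto\pi_Aa=\pi_Bb$. Define $A\otimes B$ in $\mathbb D(\mathcal C)$ as the Yoneda sum of $A\otimes B_0$ and $A_0\otimes B$ (tensored termwise), with $f\otimes g$ induced by $f_1\otimes g_0$ and $f_0\otimes g_1$. Let $\mathbf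 1$ be $0\to\mathbf 1_0\to\mathbf 1_0\oplus\mathbf 1_0\to\mathbf 1_0\to0$ (first inclusion, second projection), with unit isomorphism $\mathbf 1\otimes A\cong A$ induced by $((x,y),a)\mapsto i_A(x)+a$, and similarly $A\otimes\mathbf 1\cong A$. Let $\phi$ be the associativity constraint over $\phi_0$ obtained by identifying both $(A\otimes B)\otimes D$ and $A\otimes(B\otimes D)$ with the quotient of $$A_1\otimes B_0\otimes D_0\times_{A_0\otimes B_0\otimes D_0}A_0\otimes B_1\otimes D_0\times_{A_0\otimes B_0\otimes D_0}A_0\otimes B_0\otimes D_1$$ that identifies the three inclusions of $A_0\otimes B_0\otimes D_0$, and let $\psi$ be the commutativity constraint over $\psi_0$ induced by $\psi_0$ and $(a,b)\mapsto(b,a)$. Then: 1. $(\mathbb D(\mathcal C),\otimes,\phi,\psi,\mathbf 1)$ is a symmetric monoidal category. 2. $\Pi_0\colon\mathbb D(\mathcal C)\to\mathcal C$ is a symmetric monoidal functor, with structure isomorphisms the identities of $A_0\otimes B_0$ and of $\mathbf 1_0$. 3. If $\mathcal C$ is rigid (closed, with every $X\to X^{\vee\vee}$ and every $\underline{Hom}(X_1,Y_1)\otimes\underline{Hom}(X_2,Y_2)\to\underline{Hom}(X_1\otimes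 X_2,Y_1\otimes Y_2)$ an isomorphism, where $X^\vee=\underline{Hom}(X,\mathbf 1_0)$), then so is $\mathbb D(\mathcal C)$. Moreover, for every $A$ the dual sequence $A^\vee\colon0\to A_0^\vee\xrightarrow{\pi_A^\vee}A_1^\vee\xrightarrow{i_A^\vee}A_0^\vee\to0$ is exact, and there is a morphism $e\colon A\otimes A^\vee\to\mathbf 1$ over the evaluation of $A_0$, whose composite $A_1\otimes A_1^\vee\to(A\otimes A^\vee)_1\to\mathbf 1_0\oplus\mathbf 1_0\to\mathbf 1_0$ with the canonical map $a\otimes b\mapsto[(a\otimes\pi b,\pi a\otimes b)]$ and the first projection is the evaluation of $A_1$, and for which the induced map $A^\vee\to\underline{Hom}(A,\mathbf 1)$ is an isomorphism. -/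

import Mathlib

open CategoryTheory CategoryTheory.Limits CategoryTheory.MonoidalCategory

universe v u

noncomputable section

/-! ## Self-extensions and their Yoneda sum -/

/-- An exact sequence `0 ⟶ X ⟶ mid ⟶ X ⟶ 0`. -/
structure SelfExtension {C : Type u} [Category.{v} C] [Abelian C] (X : C) where
  mid : C
  incl : X ⟶ mid
  proj : mid ⟶ X
  zero : incl ≫ proj = 0
  shortExact : (ShortComplex.mk incl proj zero).ShortExact

namespace SelfExtension

variable {C : Type u} [Category.{v} C] [Abelian C] {X : C}

instance (E : SelfExtension X) : Mono E.incl := E.shortExact.mono_f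
instance (E : SelfExtension X) : Epi E.proj := E.shortExact.epi_g

theorem exists_lift (E : SelfExtension X) {T : C} (x : T ⟶ E.mid) (hx : x ≫ E.proj = 0) :
    ∃ w : T ⟶ X, x = w ≫ E.incl :=
  ⟨E.shortExact.exact.lift x hx, (E.shortExact.exact.lift_f x hx).symm⟩

attribute [local simp] pullback.lift_fst pullback.lift_snd pullback.lift_fst_assoc
  pullback.lift_snd_assoc

/-- A morphism of exact sequences whose two components at the outer terms are both `f`. -/
@[ext]
structure HomOver {X Y : C} (f : X ⟶ Y) (E : SelfExtension X) (F : SelfExtension Y) where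
  mid : E.mid ⟶ F.mid
  incl_mid : E.incl ≫ mid = f ≫ F.incl
  mid_proj : mid ≫ F.proj = E.proj ≫ f

namespace HomOver

variable {Y Z : C}

@[simps]
def id (E : SelfExtension X) : HomOver (𝟙 X) E E := ⟨𝟙 _, by simp, by simp⟩

@[simps]
def comp {f : X ⟶ Y} {g : Y ⟶ Z} {h : X ⟶ Z} {E : SelfExtension X} {F : SelfExtension Y}
    {G : SelfExtension Z} (m : HomOver f E F) (n : HomOver g F G) (e : f ≫ g = h) :
    HomOver h E G where
  mid := m.mid ≫ n.mid
  incl_mid := by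
    rw [← Category.assoc, m.incl_mid, Category.assoc, n.incl_mid, ← Category.assoc, e]
  mid_proj := by rw [Category.assoc, n.mid_proj, ← Category.assoc, m.mid_proj, Category.assoc, e]

theorem isIso_mid {f : X ⟶ Y} [IsIso f] {E : SelfExtension X} {F : SelfExtension Y}
    (m : HomOver f E F) : IsIso m.mid := by
  let φ : ShortComplex.mk E.incl E.proj E.zero ⟶ ShortComplex.mk F.incl F.proj F.zero :=
    { τ₁ := f, τ₂ := m.mid, τ₃ := f, comm₁₂ := m.incl_mid.symm, comm₂₃ := m.mid_proj }
  have : IsIso φ.τ₁ := by dsimp [φ]; infer_instance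
  have : IsIso φ.τ₃ := by dsimp [φ]; infer_instance
  exact ShortComplex.isIso₂_of_shortExact_of_isIso₁₃ φ E.shortExact F.shortExact

/-- By the five lemma, a morphism over an isomorphism is invertible. -/
@[simps]
def symm {f : X ≅ Y} {E : SelfExtension X} {F : SelfExtension Y} (m : HomOver f.hom E F) :
    HomOver f.inv F E :=
  haveI := m.isIso_mid
  { mid := inv m.mid
    incl_mid := by rw [IsIso.comp_inv_eq, Category.assoc, m.incl_mid, f.inv_hom_id_assoc]
    mid_proj := by
      rw [IsIso.inv_comp_eq, ← Category.assoc, m.mid_proj, Category.assoc, f.hom_inv_id,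
        Category.comp_id] }

end HomOver

/-- The fibre product `E₁ ×_X F₁`. -/
abbrev fibre (E F : SelfExtension X) : C := pullback E.proj F.proj

/-- The map `(ι_E, -ι_F) : X ⟶ E₁ ×_X F₁`. -/
def antidiag (E F : SelfExtension X) : X ⟶ fibre E F :=
  pullback.lift E.incl (-F.incl) (by simp [E.zero, F.zero])

/-- The middle term of the Yoneda sum, the quotient of `E₁ ×_X F₁` by the image of
`(ι_E, -ι_F)`. -/
abbrev sumMid (E F : SelfExtension X) : C := cokernel (antidiag E F)

def sumQuot (E F : SelfExtension X) : fibre E F ⟶ sumMid E F := cokernel.π (antidiag E F)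

/-- The map to the Yoneda sum given by a compatible pair of maps to `E₁` and `F₁`. -/
def sumMk (E F : SelfExtension X) {T : C} (a : T ⟶ E.mid) (b : T ⟶ F.mid)
    (h : a ≫ E.proj = b ≫ F.proj) : T ⟶ sumMid E F :=
  pullback.lift a b h ≫ sumQuot E F

/-- The map out of the Yoneda sum induced by a map out of `E₁ ×_X F₁`. -/
def sumDesc (E F : SelfExtension X) {T : C} (k : fibre E F ⟶ T) (h : antidiag E F ≫ k = 0) :
    sumMid E F ⟶ T :=
  cokernel.desc _ k h

instance (E F : SelfExtension X) : Epi (sumQuot E F) := by unfold sumQuot; infer_instance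

instance (E F : SelfExtension X) : Mono (antidiag E F) := by
  have : Mono (antidiag E F ≫ pullback.fst E.proj F.proj) := by
    unfold antidiag
    rw [pullback.lift_fst]
    infer_instance
  exact mono_of_mono _ (pullback.fst E.proj F.proj)

@[simp]
theorem sumQuot_desc (E F : SelfExtension X) {T : C} (k : fibre E F ⟶ T)
    (h : antidiag E F ≫ k = 0) : sumQuot E F ≫ sumDesc E F k h = k :=
  cokernel.π_desc _ _ _

theorem sumMk_desc (E F : SelfExtension X) {T S : C} (a : T ⟶ E.mid) (b : T ⟶ F.mid)
    (hab : a ≫ E.proj = b ≫ F.proj) (k : fibre E F ⟶ S) (h : antidiag E F ≫ k = 0) :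
    sumMk E F a b hab ≫ sumDesc E F k h = pullback.lift a b hab ≫ k := by
  simp [sumMk]

theorem comp_sumMk (E F : SelfExtension X) {S T : C} (t : S ⟶ T) (a : T ⟶ E.mid) (b : T ⟶ F.mid)
    (h : a ≫ E.proj = b ≫ F.proj) :
    t ≫ sumMk E F a b h = sumMk E F (t ≫ a) (t ≫ b) (by simp [h]) := by
  have e : t ≫ pullback.lift a b h =
      pullback.lift (t ≫ a) (t ≫ b) (by simp [h]) := by
    apply pullback.hom_ext <;> simp
  rw [sumMk, sumMk, ← e, Category.assoc]

theorem sumMk_congr (E F : SelfExtension X) {T : C} {a a' : T ⟶ E.mid} {b b' : T ⟶ F.mid}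
    (h : a ≫ E.proj = b ≫ F.proj) (ha : a = a') (hb : b = b') :
    sumMk E F a b h = sumMk E F a' b' (by rw [← ha, ← hb, h]) := by
  subst ha hb; rfl

theorem sumQuot_eq_mk (E F : SelfExtension X) :
    sumQuot E F = sumMk E F (pullback.fst _ _) (pullback.snd _ _) pullback.condition := by
  unfold sumMk
  rw [show pullback.lift (pullback.fst E.proj F.proj) (pullback.snd E.proj F.proj)
    pullback.condition = 𝟙 (fibre E F) from by apply pullback.hom_ext <;> simp]
  simp

theorem quot_exact (E F : SelfExtension X) :
    (ShortComplex.mk (antidiag E F) (sumQuot E F) (cokernel.condition _)).ShortExact where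
  exact := ShortComplex.exact_cokernel _
  mono_f := by dsimp; infer_instance
  epi_g := by dsimp; infer_instance

theorem sumMk_eq_zero_iff (E F : SelfExtension X) {T : C} (a : T ⟶ E.mid) (b : T ⟶ F.mid)
    (h : a ≫ E.proj = b ≫ F.proj) :
    sumMk E F a b h = 0 ↔ ∃ w : T ⟶ X, a = w ≫ E.incl ∧ b = -(w ≫ F.incl) := by
  constructor
  · intro h0
    obtain ⟨w, hw⟩ : ∃ w, w ≫ antidiag E F = pullback.lift a b h :=
      ⟨(quot_exact E F).exact.lift _ h0, (quot_exact E F).exact.lift_f _ h0⟩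
    refine ⟨w, ?_, ?_⟩
    · have := congrArg (· ≫ pullback.fst E.proj F.proj) hw
      simpa [antidiag] using this.symm
    · have := congrArg (· ≫ pullback.snd E.proj F.proj) hw
      simpa [antidiag] using this.symm
  · rintro ⟨w, rfl, rfl⟩
    have : pullback.lift (w ≫ E.incl) (-(w ≫ F.incl)) h = w ≫ antidiag E F := by
      apply pullback.hom_ext <;> simp [antidiag]
    unfold sumMk
    rw [this, Category.assoc]
    simp [sumQuot]

theorem sumMk_sub (E F : SelfExtension X) {T : C} (a a' : T ⟶ E.mid) (b b' : T ⟶ F.mid)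
    (h : a ≫ E.proj = b ≫ F.proj) (h' : a' ≫ E.proj = b' ≫ F.proj) :
    sumMk E F a b h - sumMk E F a' b' h' =
      sumMk E F (a - a') (b - b') (by simp [Preadditive.sub_comp, h, h']) := by
  have e : pullback.lift a b h - pullback.lift a' b' h' =
      pullback.lift (a - a') (b - b') (by simp [Preadditive.sub_comp, h, h']) := by
    apply pullback.hom_ext <;> simp [Preadditive.sub_comp]
  rw [sumMk, sumMk, sumMk, ← e, Preadditive.sub_comp]

theorem sumMk_eq_iff (E F : SelfExtension X) {T : C} {a a' : T ⟶ E.mid} {b b' : T ⟶ F.mid}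
    (h : a ≫ E.proj = b ≫ F.proj) (h' : a' ≫ E.proj = b' ≫ F.proj) :
    sumMk E F a b h = sumMk E F a' b' h' ↔
      ∃ w : T ⟶ X, a = a' + w ≫ E.incl ∧ b = b' - w ≫ F.incl := by
  rw [← sub_eq_zero, sumMk_sub, sumMk_eq_zero_iff]
  constructor <;> rintro ⟨w, h1, h2⟩ <;> refine ⟨w, ?_, ?_⟩
  · rw [← h1]; abel
  · rw [eq_sub_iff_add_eq, ← sub_eq_zero, add_sub_right_comm, h2]; abel
  · rw [h1]; abel
  · rw [h2]; abel

/-- The map `X ⟶ E₁ ×_X F₁ ⟶ (E ⋆ F)₁`, `x ↦ [(ι_E x, 0)] = [(0, ι_F x)]`. -/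
def sumIncl (E F : SelfExtension X) : X ⟶ sumMid E F :=
  sumMk E F E.incl 0 (by simp [E.zero])

theorem sumIncl_eq (E F : SelfExtension X) :
    sumIncl E F = sumMk E F 0 F.incl (by simp [F.zero]) := by
  unfold sumIncl
  rw [sumMk_eq_iff]
  exact ⟨𝟙 X, by simp, by simp⟩

/-- The map `(E ⋆ F)₁ ⟶ X`, `[(a, b)] ↦ π_E a = π_F b`. -/
def sumProj (E F : SelfExtension X) : sumMid E F ⟶ X :=
  sumDesc E F (pullback.fst E.proj F.proj ≫ E.proj) (by simp [antidiag, E.zero])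

theorem sumMk_proj (E F : SelfExtension X) {T : C} (a : T ⟶ E.mid) (b : T ⟶ F.mid)
    (h : a ≫ E.proj = b ≫ F.proj) : sumMk E F a b h ≫ sumProj E F = a ≫ E.proj := by
  simp [sumProj, sumMk_desc]

theorem sumQuot_proj (E F : SelfExtension X) :
    sumQuot E F ≫ sumProj E F = pullback.fst E.proj F.proj ≫ E.proj := by
  simp [sumProj]

theorem exists_sumMk (E F : SelfExtension X) {T : C} (x : T ⟶ sumMid E F) :
    ∃ (T' : C) (t : T' ⟶ T) (_ : Epi t) (a : T' ⟶ E.mid) (b : T' ⟶ F.mid)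
      (h : a ≫ E.proj = b ≫ F.proj), t ≫ x = sumMk E F a b h := by
  obtain ⟨T', t, ht, y, hy⟩ := surjective_up_to_refinements_of_epi (sumQuot E F) x
  refine ⟨T', t, ht, y ≫ pullback.fst _ _, y ≫ pullback.snd _ _, ?_, ?_⟩
  · simp [pullback.condition]
  · rw [hy, sumQuot_eq_mk, comp_sumMk]

theorem sum_zero (E F : SelfExtension X) : sumIncl E F ≫ sumProj E F = 0 := by
  simp [sumIncl, sumMk_proj, E.zero]

theorem sum_shortExact (E F : SelfExtension X) :
    (ShortComplex.mk (sumIncl E F) (sumProj E F) (sum_zero E F)).ShortExact where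
  exact := by
    rw [ShortComplex.exact_iff_exact_up_to_refinements]
    intro T x hx
    obtain ⟨T', t, ht, a, b, h, e⟩ := exists_sumMk E F x
    have h0 : a ≫ E.proj = 0 := by
      have := congrArg (t ≫ ·) hx
      dsimp at this
      rwa [← Category.assoc, e, sumMk_proj, comp_zero] at this
    obtain ⟨w, rfl⟩ := E.exists_lift a h0
    obtain ⟨w', rfl⟩ := F.exists_lift b (h ▸ h0)
    refine ⟨T', t, ht, w + w', ?_⟩
    dsimp
    rw [e, sumIncl, comp_sumMk, sumMk_eq_iff]
    exact ⟨-w', by simp, by simp⟩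
  mono_f := by
    have key : ∀ {T : C} (x : T ⟶ X), x ≫ sumIncl E F = 0 → x = 0 := by
      intro T x hx
      unfold sumIncl at hx
      rw [comp_sumMk, sumMk_eq_zero_iff] at hx
      obtain ⟨w, h1, h2⟩ := hx
      rw [cancel_mono] at h1
      rw [h1, ← cancel_mono F.incl]
      simpa using h2.symm
    exact Preadditive.mono_of_cancel_zero _ fun x hx => key x hx
  epi_g := by
    dsimp
    have : Epi (sumQuot E F ≫ sumProj E F) := by
      unfold sumProj
      rw [sumQuot_desc]
      exact epi_comp _ _
    exact epi_of_epi (sumQuot E F) _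

/-- The Yoneda sum (Baer sum) `E ⋆ F`. -/
abbrev yonedaSum (E F : SelfExtension X) : SelfExtension X where
  mid := sumMid E F
  incl := sumIncl E F
  proj := sumProj E F
  zero := sum_zero E F
  shortExact := sum_shortExact E F

/-- The morphism `m ⋆ n`, induced by the map `(a, b) ↦ (m a, n b)` of fibre products. -/
abbrev sumMap {Y : C} {f : X ⟶ Y} {E F : SelfExtension X} {E' F' : SelfExtension Y}
    (m : HomOver f E E') (n : HomOver f F F') :
    HomOver f (yonedaSum E F) (yonedaSum E' F') where
  mid := sumDesc E F
    (sumMk E' F' (pullback.fst _ _ ≫ m.mid) (pullback.snd _ _ ≫ n.mid)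
      (by simp [m.mid_proj, n.mid_proj, pullback.condition_assoc]))
    (by
      rw [comp_sumMk, sumMk_eq_zero_iff]
      exact ⟨f, by simp [antidiag, m.incl_mid], by simp [antidiag, n.incl_mid]⟩)
  incl_mid := by
    dsimp only [sumIncl]
    rw [sumMk_desc, comp_sumMk, comp_sumMk]
    exact sumMk_congr _ _ _ (by simp [m.incl_mid]) (by simp)
  mid_proj := by
    change _ ≫ sumProj E' F' = sumProj E F ≫ f
    rw [← cancel_epi (sumQuot E F), ← Category.assoc, sumQuot_desc, sumMk_proj, ← Category.assoc,
      sumQuot_proj, Category.assoc, m.mid_proj, Category.assoc]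

/-- The commutativity of the Yoneda sum, induced by `(a, b) ↦ (b, a)`. -/
abbrev sumSwap (E F : SelfExtension X) : HomOver (𝟙 X) (yonedaSum E F) (yonedaSum F E) where
  mid := sumDesc E F
    (sumMk F E (pullback.snd _ _) (pullback.fst _ _) pullback.condition.symm)
    (by
      rw [comp_sumMk, sumMk_eq_zero_iff]
      exact ⟨-𝟙 X, by simp [antidiag], by simp [antidiag]⟩)
  incl_mid := by
    change sumIncl E F ≫ _ = 𝟙 X ≫ sumIncl F E
    rw [sumIncl_eq F E]
    unfold sumIncl
    rw [sumMk_desc, comp_sumMk, comp_sumMk]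
    exact sumMk_congr _ _ _ (by simp) (by simp)
  mid_proj := by
    change _ ≫ sumProj F E = sumProj E F ≫ 𝟙 X
    rw [← cancel_epi (sumQuot E F), ← Category.assoc, sumQuot_desc, sumMk_proj, Category.comp_id,
      sumQuot_proj, pullback.condition]

/-! ### Associativity of the Yoneda sum -/

section Assoc

variable (E F G : SelfExtension X)

/-- The triple fibre product `E₁ ×_X F₁ ×_X G₁`. -/
abbrev triple : C := pullback (pullback.fst E.proj F.proj ≫ E.proj) G.proj

abbrev triple₁ : triple E F G ⟶ E.mid := pullback.fst _ _ ≫ pullback.fst _ _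
abbrev triple₂ : triple E F G ⟶ F.mid := pullback.fst _ _ ≫ pullback.snd _ _
abbrev triple₃ : triple E F G ⟶ G.mid := pullback.snd _ _

theorem triple_condition₁₂ : triple₁ E F G ≫ E.proj = triple₂ E F G ≫ F.proj := by
  simp [pullback.condition]

theorem triple_condition₁₃ : triple₁ E F G ≫ E.proj = triple₃ E F G ≫ G.proj := by
  simp [← pullback.condition]

/-- The quotient map `(a, b, c) ↦ [([(a, b)], c)]` to the middle term of `(E ⋆ F) ⋆ G`. -/
def leftBracket : triple E F G ⟶ sumMid (yonedaSum E F) G :=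
  sumMk (yonedaSum E F) G
    (sumMk E F (triple₁ E F G) (triple₂ E F G) (triple_condition₁₂ E F G)) (triple₃ E F G)
    (by rw [sumMk_proj, triple_condition₁₃])

/-- The quotient map `(a, b, c) ↦ [(a, [(b, c)])]` to the middle term of `E ⋆ (F ⋆ G)`. -/
def rightBracket : triple E F G ⟶ sumMid E (yonedaSum F G) :=
  sumMk E (yonedaSum F G) (triple₁ E F G)
    (sumMk F G (triple₂ E F G) (triple₃ E F G)
      (by rw [← triple_condition₁₂, triple_condition₁₃]))
    (by rw [sumMk_proj, triple_condition₁₂])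

instance : Epi (leftBracket E F G) := by
  rw [epi_iff_surjective_up_to_refinements]
  intro T x
  obtain ⟨T₁, t₁, ht₁, s, c, hs, e₁⟩ := exists_sumMk (yonedaSum E F) G x
  obtain ⟨T₂, t₂, ht₂, a, b, hab, e₂⟩ := exists_sumMk E F s
  have hc : a ≫ E.proj = (t₂ ≫ c) ≫ G.proj := by
    rw [Category.assoc, ← hs, ← Category.assoc]
    dsimp only [yonedaSum]
    rw [e₂, sumMk_proj]
  refine ⟨T₂, t₂ ≫ t₁, epi_comp _ _,
    pullback.lift (pullback.lift a b hab) (t₂ ≫ c) (by simpa using hc), ?_⟩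
  rw [Category.assoc, e₁, leftBracket, comp_sumMk, comp_sumMk]
  apply sumMk_congr
  · rw [e₂, comp_sumMk]
    exact sumMk_congr _ _ _ (by simp) (by simp)
  · simp

theorem comp_rightBracket_eq_zero {T : C} (k : T ⟶ triple E F G)
    (h : k ≫ leftBracket E F G = 0) : k ≫ rightBracket E F G = 0 := by
  unfold leftBracket at h
  rw [comp_sumMk, sumMk_eq_zero_iff] at h
  obtain ⟨w, h₁, h₂⟩ := h
  replace h₁ : k ≫ sumMk E F (triple₁ E F G) (triple₂ E F G) (triple_condition₁₂ E F G) =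
    w ≫ sumMk E F E.incl 0 (by simp [E.zero]) := h₁
  rw [comp_sumMk, comp_sumMk, sumMk_eq_iff] at h₁
  obtain ⟨w', h₃, h₄⟩ := h₁
  unfold rightBracket
  rw [comp_sumMk, sumMk_eq_zero_iff]
  refine ⟨w + w', by rw [h₃, Preadditive.add_comp], ?_⟩
  change _ = -((w + w') ≫ sumMk F G F.incl 0 (by simp [F.zero]))
  rw [← Preadditive.neg_comp, comp_sumMk, comp_sumMk, sumMk_eq_iff]
  exact ⟨w, by rw [h₄]; simp, by rw [h₂]; simp⟩

/-- The associativity isomorphism `(E ⋆ F) ⋆ G ≅ E ⋆ (F ⋆ G)`: both sides are the quotient of the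
triple fibre product that identifies the three inclusions of `X`. -/
abbrev sumAssoc : HomOver (𝟙 X) (yonedaSum (yonedaSum E F) G) (yonedaSum E (yonedaSum F G)) where
  mid := Abelian.epiDesc (leftBracket E F G) (rightBracket E F G)
    (comp_rightBracket_eq_zero E F G _ (kernel.condition _))
  incl_mid := by
    let j : X ⟶ triple E F G := pullback.lift (pullback.lift E.incl 0 (by simp [E.zero])) 0
      (by simp [E.zero])
    have h₁ : sumIncl (yonedaSum E F) G = j ≫ leftBracket E F G := by
      unfold leftBracket sumIncl
      rw [comp_sumMk]
      apply sumMk_congr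
      · change sumMk E F _ _ _ = _
        rw [comp_sumMk]
        exact sumMk_congr _ _ _ (by simp [j]) (by simp [j])
      · simp [j]
    have h₂ : j ≫ rightBracket E F G = sumIncl E (yonedaSum F G) := by
      unfold rightBracket sumIncl
      rw [comp_sumMk]
      apply sumMk_congr
      · simp [j]
      · rw [comp_sumMk, sumMk_eq_zero_iff]
        exact ⟨0, by simp [j], by simp [j]⟩
    change sumIncl (yonedaSum E F) G ≫ _ = 𝟙 X ≫ sumIncl E (yonedaSum F G)
    rw [h₁, Category.assoc, Abelian.comp_epiDesc, h₂, Category.id_comp]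
  mid_proj := by
    change _ ≫ sumProj E (yonedaSum F G) = sumProj (yonedaSum E F) G ≫ 𝟙 X
    rw [← cancel_epi (leftBracket E F G), Category.comp_id, ← Category.assoc,
      Abelian.comp_epiDesc]
    unfold leftBracket rightBracket
    rw [sumMk_proj, sumMk_proj]
    change _ = _ ≫ sumProj E F
    rw [sumMk_proj]

end Assoc

/-! ### Exact functors and Yoneda sums -/

section Exact

variable (G : C ⥤ C) [G.PreservesZeroMorphisms] [PreservesFiniteLimits G]
  [PreservesFiniteColimits G]

/-- The exact sequence obtained by applying an exact functor termwise. -/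
abbrev map (E : SelfExtension X) : SelfExtension (G.obj X) where
  mid := G.obj E.mid
  incl := G.map E.incl
  proj := G.map E.proj
  zero := by rw [← G.map_comp, E.zero, G.map_zero]
  shortExact := E.shortExact.map_of_exact G

/-- The canonical map `(G E ⋆ G F)₁ ⟶ G ((E ⋆ F)₁)` for an exact functor `G`; it uses that `G`
preserves the fibre product `E₁ ×_X F₁`. -/
def mapSumMid (E F : SelfExtension X) : sumMid (E.map G) (F.map G) ⟶ G.obj (sumMid E F) :=
  sumDesc (E.map G) (F.map G)
    ((PreservesPullback.iso G E.proj F.proj).inv ≫ G.map (sumQuot E F)) (by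
      have : antidiag (E.map G) (F.map G) ≫ (PreservesPullback.iso G E.proj F.proj).inv =
          G.map (antidiag E F) := by
        rw [Iso.comp_inv_eq]
        apply pullback.hom_ext
        · simp [antidiag]
        · have : Functor.Additive G := Functor.additive_of_preserves_binary_products G
          simp [antidiag]
      rw [← Category.assoc, this, ← G.map_comp]
      simp [sumQuot])

theorem sumMk_mapSumMid (E F : SelfExtension X) {T : C} (a : T ⟶ G.obj E.mid) (b : T ⟶ G.obj F.mid)
    (h : a ≫ G.map E.proj = b ≫ G.map F.proj) :
    sumMk (E.map G) (F.map G) a b h ≫ mapSumMid G E F =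
      pullback.lift a b h ≫ (PreservesPullback.iso G E.proj F.proj).inv ≫ G.map (sumQuot E F) := by
  unfold mapSumMid
  rw [sumMk_desc]

theorem map_sumMk (E F : SelfExtension X) {T : C} (a : T ⟶ E.mid) (b : T ⟶ F.mid)
    (h : a ≫ E.proj = b ≫ F.proj) :
    G.map (sumMk E F a b h) = sumMk (E.map G) (F.map G) (G.map a) (G.map b)
      (by rw [← G.map_comp, h, G.map_comp]) ≫ mapSumMid G E F := by
  rw [sumMk_mapSumMid, sumMk, G.map_comp, ← Category.assoc (pullback.lift _ _ _)]
  congr 1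
  rw [Iso.eq_comp_inv]
  apply pullback.hom_ext <;> simp

theorem sumIncl_mapSumMid (E F : SelfExtension X) :
    sumIncl (E.map G) (F.map G) ≫ mapSumMid G E F = G.map (sumIncl E F) := by
  unfold sumIncl
  rw [map_sumMk]
  congr 1
  exact sumMk_congr _ _ _ rfl (by simp)

theorem mapSumMid_proj (E F : SelfExtension X) :
    mapSumMid G E F ≫ G.map (sumProj E F) = sumProj (E.map G) (F.map G) := by
  rw [← cancel_epi (sumQuot (E.map G) (F.map G))]
  unfold mapSumMid sumProj
  simp only [sumQuot_desc, ← Category.assoc]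
  simp only [Category.assoc, ← G.map_comp, sumQuot_desc]
  simp

/-- The canonical isomorphism `G E ⋆ G F ≅ G (E ⋆ F)` for an exact functor `G`. -/
abbrev mapSum (E F : SelfExtension X) :
    HomOver (𝟙 (G.obj X)) (yonedaSum (E.map G) (F.map G)) ((yonedaSum E F).map G) where
  mid := mapSumMid G E F
  incl_mid := by simp [sumIncl_mapSumMid]
  mid_proj := by simp [mapSumMid_proj]

end Exact

end SelfExtension

/-! ## The prolongation -/

/-- An object of the prolongation of `C`: an exact sequence `0 ⟶ X₀ ⟶ X₁ ⟶ X₀ ⟶ 0`. -/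
structure Prolongation (C : Type u) [Category.{v} C] [Abelian C] where
  base : C
  ext : SelfExtension base

namespace Prolongation

open SelfExtension

section Category

variable {C : Type u} [Category.{v} C] [Abelian C]

/-- A morphism of exact sequences whose two components at `X₀` coincide. -/
structure Hom (A B : Prolongation C) where
  base : A.base ⟶ B.base
  ext : HomOver base A.ext B.ext

theorem Hom.ext' {A B : Prolongation C} {f g : Hom A B} (h₀ : f.base = g.base)
    (h₁ : f.ext.mid = g.ext.mid) : f = g := by
  obtain ⟨f₀, f₁⟩ := f
  obtain ⟨g₀, g₁⟩ := g
  obtain rfl : f₀ = g₀ := h₀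
  exact congrArg (Hom.mk f₀) (HomOver.ext h₁)

@[simps]
instance : Category (Prolongation C) where
  Hom := Hom
  id _ := ⟨𝟙 _, HomOver.id _⟩
  comp f g := ⟨f.base ≫ g.base, f.ext.comp g.ext rfl⟩
  id_comp _ := Hom.ext' (Category.id_comp _) (Category.id_comp _)
  comp_id _ := Hom.ext' (Category.comp_id _) (Category.comp_id _)
  assoc _ _ _ := Hom.ext' (Category.assoc _ _ _) (Category.assoc _ _ _)

theorem hom_ext {A B : Prolongation C} {f g : A ⟶ B} (h₀ : f.base = g.base)
    (h₁ : f.ext.mid = g.ext.mid) : f = g :=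
  Hom.ext' h₀ h₁

/-- The isomorphism given by a morphism of exact sequences over an isomorphism of `C`. -/
@[simps]
def isoOver {A B : Prolongation C} (f : A.base ≅ B.base) (m : HomOver f.hom A.ext B.ext) :
    A ≅ B where
  hom := ⟨f.hom, m⟩
  inv := ⟨f.inv, m.symm⟩
  hom_inv_id := by
    have := m.isIso_mid
    apply hom_ext <;> simp
  inv_hom_id := by
    have := m.isIso_mid
    apply hom_ext <;> simp

variable (C) in
/-- The functor `X ↦ X₀`. -/
@[simps]
def Pi₀ : Prolongation C ⥤ C where
  obj A := A.base
  map f := f.base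

end Category

end Prolongation

/-! ## The tensor structure on the prolongation -/

section Tensor

variable {C : Type u} [Category.{v} C] [Abelian C] [MonoidalCategory C] [MonoidalPreadditive C]
  [SymmetricCategory C]
  [∀ X : C, PreservesFiniteLimits (tensorLeft X)]
  [∀ X : C, PreservesFiniteColimits (tensorLeft X)]

instance preservesFiniteLimits_tensorRight' (X : C) : PreservesFiniteLimits (tensorRight X) :=
  preservesFiniteLimits_of_natIso (BraidedCategory.tensorLeftIsoTensorRight X)

instance preservesFiniteColimits_tensorRight' (X : C) : PreservesFiniteColimits (tensorRight X) :=
  preservesFiniteColimits_of_natIso (BraidedCategory.tensorLeftIsoTensorRight X)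

namespace SelfExtension

variable {X Y : C}

/-- The exact sequence `E ⊗ Z`, tensored termwise. -/
abbrev tensorR (E : SelfExtension X) (Z : C) : SelfExtension (X ⊗ Z) where
  mid := E.mid ⊗ Z
  incl := E.incl ▷ Z
  proj := E.proj ▷ Z
  zero := (E.map (tensorRight Z)).zero
  shortExact := (E.map (tensorRight Z)).shortExact

/-- The exact sequence `Z ⊗ E`, tensored termwise. -/
abbrev tensorL (Z : C) (E : SelfExtension X) : SelfExtension (Z ⊗ X) where
  mid := Z ⊗ E.mid
  incl := Z ◁ E.incl
  proj := Z ◁ E.proj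
  zero := (E.map (tensorLeft Z)).zero
  shortExact := (E.map (tensorLeft Z)).shortExact

/-- The canonical isomorphism `(E ⊗ Z) ⋆ (F ⊗ Z) ≅ (E ⋆ F) ⊗ Z`. -/
abbrev sumTensorR (E F : SelfExtension X) (Z : C) :
    HomOver (𝟙 (X ⊗ Z)) (yonedaSum (E.tensorR Z) (F.tensorR Z)) ((yonedaSum E F).tensorR Z) :=
  mapSum (tensorRight Z) E F

/-- The canonical isomorphism `(Z ⊗ E) ⋆ (Z ⊗ F) ≅ Z ⊗ (E ⋆ F)`. -/
abbrev sumTensorL (Z : C) (E F : SelfExtension X) :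
    HomOver (𝟙 (Z ⊗ X)) (yonedaSum (tensorL Z E) (tensorL Z F)) (tensorL Z (yonedaSum E F)) :=
  mapSum (tensorLeft Z) E F

@[simps]
def HomOver.tensorR {f : X ⟶ Y} {E : SelfExtension X} {F : SelfExtension Y} (m : HomOver f E F)
    {Z W : C} (g : Z ⟶ W) : HomOver (f ⊗ₘ g) (E.tensorR Z) (F.tensorR W) where
  mid := m.mid ⊗ₘ g
  incl_mid := by
    change E.incl ▷ Z ≫ _ = _ ≫ F.incl ▷ W
    rw [← tensorHom_id, ← tensorHom_id, tensorHom_comp_tensorHom, tensorHom_comp_tensorHom,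
      m.incl_mid, Category.id_comp, Category.comp_id]
  mid_proj := by
    change _ ≫ F.proj ▷ W = E.proj ▷ Z ≫ _
    rw [← tensorHom_id, ← tensorHom_id, tensorHom_comp_tensorHom, tensorHom_comp_tensorHom,
      m.mid_proj, Category.id_comp, Category.comp_id]

@[simps]
def HomOver.tensorL {f : X ⟶ Y} {E : SelfExtension X} {F : SelfExtension Y}
    {Z W : C} (g : Z ⟶ W) (m : HomOver f E F) : HomOver (g ⊗ₘ f) (tensorL Z E) (tensorL W F) where
  mid := g ⊗ₘ m.mid
  incl_mid := by
    change Z ◁ E.incl ≫ _ = _ ≫ W ◁ F.incl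
    rw [← id_tensorHom, ← id_tensorHom, tensorHom_comp_tensorHom, tensorHom_comp_tensorHom,
      m.incl_mid, Category.id_comp, Category.comp_id]
  mid_proj := by
    change _ ≫ W ◁ F.proj = Z ◁ E.proj ≫ _
    rw [← id_tensorHom, ← id_tensorHom, tensorHom_comp_tensorHom, tensorHom_comp_tensorHom,
      m.mid_proj, Category.id_comp, Category.comp_id]

/-- The associativity constraint of `C`, applied termwise. -/
@[simps]
def assocLLR (E : SelfExtension X) (Y Z : C) :
    HomOver (α_ X Y Z).hom ((E.tensorR Y).tensorR Z) (E.tensorR (Y ⊗ Z)) :=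
  ⟨(α_ _ _ _).hom, by simp, by simp⟩

@[simps]
def assocM (Y : C) (E : SelfExtension X) (Z : C) :
    HomOver (α_ Y X Z).hom ((tensorL Y E).tensorR Z) (tensorL Y (E.tensorR Z)) :=
  ⟨(α_ _ _ _).hom, by simp, by simp⟩

@[simps]
def assocR (Y Z : C) (E : SelfExtension X) :
    HomOver (α_ Y Z X).hom (tensorL (Y ⊗ Z) E) (tensorL Y (tensorL Z E)) :=
  ⟨(α_ _ _ _).hom, by simp, by simp⟩

@[simps]
def braidR (E : SelfExtension X) (Z : C) : HomOver (β_ X Z).hom (E.tensorR Z) (tensorL Z E) :=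
  ⟨(β_ _ _).hom, by simp, by simp⟩

@[simps]
def braidL (Z : C) (E : SelfExtension X) : HomOver (β_ Z X).hom (tensorL Z E) (E.tensorR Z) :=
  ⟨(β_ _ _).hom, by simp, by simp⟩

/-- The split sequence `0 ⟶ X ⟶ X ⊞ X ⟶ X ⟶ 0`. -/
abbrev split (X : C) : SelfExtension X where
  mid := X ⊞ X
  incl := biprod.inl
  proj := biprod.snd
  zero := by simp
  shortExact := (ShortComplex.Splitting.ofHasBinaryBiproduct X X).shortExact

attribute [local simp] pullback.lift_fst pullback.lift_snd pullback.lift_fst_assoc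
  pullback.lift_snd_assoc

/-- The isomorphism `split X ⋆ E ≅ E` induced by `((x, y), a) ↦ ι x + a`. -/
abbrev splitSum (E : SelfExtension X) : HomOver (𝟙 X) (yonedaSum (split X) E) E where
  mid := sumDesc (split X) E
    (pullback.fst _ _ ≫ biprod.fst ≫ E.incl + pullback.snd _ _) (by simp [antidiag])
  incl_mid := by
    change sumIncl (split X) E ≫ _ = 𝟙 X ≫ E.incl
    unfold sumIncl
    rw [sumMk_desc]
    simp
  mid_proj := by
    change _ ≫ E.proj = sumProj (split X) E ≫ 𝟙 X
    rw [← cancel_epi (sumQuot _ _), ← Category.assoc, sumQuot_desc, Category.comp_id,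
      sumQuot_proj, pullback.condition]
    simp [E.zero]

/-- The isomorphism `E ⋆ split X ≅ E` induced by `(a, (x, y)) ↦ a + ι x`. -/
abbrev sumSplit (E : SelfExtension X) : HomOver (𝟙 X) (yonedaSum E (split X)) E where
  mid := sumDesc E (split X)
    (pullback.fst _ _ + pullback.snd _ _ ≫ biprod.fst ≫ E.incl) (by simp [antidiag])
  incl_mid := by
    change sumIncl E (split X) ≫ _ = 𝟙 X ≫ E.incl
    unfold sumIncl
    rw [sumMk_desc]
    simp
  mid_proj := by
    change _ ≫ E.proj = sumProj E (split X) ≫ 𝟙 X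
    rw [← cancel_epi (sumQuot _ _), ← Category.assoc, sumQuot_desc, Category.comp_id,
      sumQuot_proj]
    simp [E.zero]

/-- `(1 ⊞ 1) ⊗ X ≅ X ⊞ X`. -/
@[simps]
def splitUnitR (X : C) : HomOver (λ_ X).hom ((split (𝟙_ C)).tensorR X) (split X) where
  mid := biprod.lift (biprod.fst ▷ X ≫ (λ_ X).hom) (biprod.snd ▷ X ≫ (λ_ X).hom)
  incl_mid := by
    apply biprod.hom_ext
    · simp [← comp_whiskerRight_assoc]
    · simp [← comp_whiskerRight_assoc]
  mid_proj := by simp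

/-- `X ⊗ (1 ⊞ 1) ≅ X ⊞ X`. -/
@[simps]
def splitUnitL (X : C) : HomOver (ρ_ X).hom (tensorL X (split (𝟙_ C))) (split X) where
  mid := biprod.lift (X ◁ biprod.fst ≫ (ρ_ X).hom) (X ◁ biprod.snd ≫ (ρ_ X).hom)
  incl_mid := by
    apply biprod.hom_ext
    · simp [← whiskerLeft_comp_assoc]
    · simp [← whiskerLeft_comp_assoc]
  mid_proj := by simp

/-- The left unit isomorphism of `C`, applied termwise. -/
@[simps]
def unitL (E : SelfExtension X) : HomOver (λ_ X).hom (tensorL (𝟙_ C) E) E :=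
  ⟨(λ_ _).hom, by simp, by simp⟩

/-- The right unit isomorphism of `C`, applied termwise. -/
@[simps]
def unitR (E : SelfExtension X) : HomOver (ρ_ X).hom (E.tensorR (𝟙_ C)) E :=
  ⟨(ρ_ _).hom, by simp, by simp⟩

end SelfExtension

namespace Prolongation

open SelfExtension

/-- The tensor product `A ⊗ B`: the Yoneda sum of `A ⊗ B₀` and `A₀ ⊗ B`. -/
abbrev tensorObj (A B : Prolongation C) : Prolongation C where
  base := A.base ⊗ B.base
  ext := yonedaSum (A.ext.tensorR B.base) (tensorL A.base B.ext)

/-- The tensor product of morphisms, induced by `f₁ ⊗ g₀` and `f₀ ⊗ g₁`. -/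
abbrev tensorHom {A B A' B' : Prolongation C} (f : A ⟶ A') (g : B ⟶ B') :
    tensorObj A B ⟶ tensorObj A' B' where
  base := f.base ⊗ₘ g.base
  ext := sumMap (f.ext.tensorR g.base) (HomOver.tensorL f.base g.ext)

variable (C) in
/-- The unit object `0 ⟶ 1 ⟶ 1 ⊞ 1 ⟶ 1 ⟶ 0`. -/
abbrev unit : Prolongation C where
  base := 𝟙_ C
  ext := split (𝟙_ C)

/-- The associativity constraint, over that of `C`: it is the composite
`(A₁B₀ ⋆ A₀B₁)C₀ ⋆ (A₀B₀)C₁ ≅ ((A₁B₀)C₀ ⋆ (A₀B₁)C₀) ⋆ (A₀B₀)C₁ ≅`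
`(A₁B₀)C₀ ⋆ ((A₀B₁)C₀ ⋆ (A₀B₀)C₁) ≅ A₁(B₀C₀) ⋆ (A₀(B₁C₀) ⋆ A₀(B₀C₁)) ≅`
`A₁(B₀C₀) ⋆ A₀(B₁C₀ ⋆ B₀C₁)`. -/
def associator (A B D : Prolongation C) :
    tensorObj (tensorObj A B) D ≅ tensorObj A (tensorObj B D) :=
  isoOver (A := tensorObj (tensorObj A B) D) (B := tensorObj A (tensorObj B D))
    (α_ A.base B.base D.base)
    ((((sumMap (HomOver.symm (f := Iso.refl _)
            (sumTensorR (A.ext.tensorR B.base) (tensorL A.base B.ext) D.base))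
          (HomOver.id (tensorL (A.base ⊗ B.base) D.ext))).comp
        (sumAssoc _ _ _) (Category.id_comp _)).comp
      (sumMap (assocLLR A.ext B.base D.base)
        (sumMap (assocM A.base B.ext D.base) (assocR A.base B.base D.ext)))
        (Category.id_comp _)).comp
      (sumMap (HomOver.id _) (sumTensorL A.base (B.ext.tensorR D.base) (tensorL B.base D.ext)))
      (Category.comp_id _))

/-- The commutativity constraint, over that of `C`: `A₁B₀ ⋆ A₀B₁ ≅ B₀A₁ ⋆ B₁A₀ ≅ B₁A₀ ⋆ B₀A₁`. -/
def braiding (A B : Prolongation C) : tensorObj A B ≅ tensorObj B A :=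
  isoOver (A := tensorObj A B) (B := tensorObj B A) (β_ A.base B.base)
    ((sumMap (braidR A.ext B.base) (braidL A.base B.ext)).comp (sumSwap _ _) (Category.comp_id _))

/-- The left unit constraint, `(1 ⊞ 1)A₀ ⋆ 1A₁ ≅ (A₀ ⊞ A₀) ⋆ A₁ ≅ A₁`. -/
def leftUnitor (A : Prolongation C) : tensorObj (unit C) A ≅ A :=
  isoOver (A := tensorObj (unit C) A) (B := A) (λ_ A.base)
    ((sumMap (splitUnitR A.base) (unitL A.ext)).comp (splitSum A.ext) (Category.comp_id _))

/-- The right unit constraint, `A₁1 ⋆ A₀(1 ⊞ 1) ≅ A₁ ⋆ (A₀ ⊞ A₀) ≅ A₁`. -/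
def rightUnitor (A : Prolongation C) : tensorObj A (unit C) ≅ A :=
  isoOver (A := tensorObj A (unit C)) (B := A) (ρ_ A.base)
    ((sumMap (unitR A.ext) (splitUnitL A.base)).comp (sumSplit A.ext) (Category.comp_id _))

/-- The tensor product, unit object and constraints of the prolongation, as data. -/
instance tensorStruct : MonoidalCategoryStruct (Prolongation C) where
  tensorObj := tensorObj
  tensorHom := tensorHom
  whiskerLeft A _ _ g := tensorHom (𝟙 A) g
  whiskerRight f B := tensorHom f (𝟙 B)
  tensorUnit := unit C
  associator := associator
  leftUnitor := leftUnitor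
  rightUnitor := rightUnitor

/-- The map `A₁ ⊗ B₁ ⟶ (A ⊗ B)₁`, `a ⊗ b ↦ [(a ⊗ π b, π a ⊗ b)]`. -/
def tensorMid (A B : Prolongation C) : A.ext.mid ⊗ B.ext.mid ⟶ (tensorObj A B).ext.mid :=
  sumMk (A.ext.tensorR B.base) (tensorL A.base B.ext)
    (A.ext.mid ◁ B.ext.proj) (A.ext.proj ▷ B.ext.mid) (whisker_exchange _ _)

end Prolongation

end Tensor

/-! ## Monoidal structures on a category -/

section Monoidal

variable {D : Type u} [Category.{v} D]

/-- The given tensor product, unit object and constraints satisfy the axioms of a monoidal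
category. -/
def IsMonoidalStruct (S : MonoidalCategoryStruct D) : Prop :=
  ∃ M : MonoidalCategory D, M.toMonoidalCategoryStruct = S

/-- The monoidal category with the given data. -/
abbrev IsMonoidalStruct.monoidalCategory {S : MonoidalCategoryStruct D}
    (h : IsMonoidalStruct S) : MonoidalCategory D where
  __ := S
  tensorHom_def := by obtain ⟨M, rfl⟩ := h; exact M.tensorHom_def
  id_tensorHom_id := by obtain ⟨M, rfl⟩ := h; exact M.id_tensorHom_id
  tensorHom_comp_tensorHom := by obtain ⟨M, rfl⟩ := h; exact M.tensorHom_comp_tensorHom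
  whiskerLeft_id := by obtain ⟨M, rfl⟩ := h; exact M.whiskerLeft_id
  id_whiskerRight := by obtain ⟨M, rfl⟩ := h; exact M.id_whiskerRight
  associator_naturality := by obtain ⟨M, rfl⟩ := h; exact M.associator_naturality
  leftUnitor_naturality := by obtain ⟨M, rfl⟩ := h; exact M.leftUnitor_naturality
  rightUnitor_naturality := by obtain ⟨M, rfl⟩ := h; exact M.rightUnitor_naturality
  pentagon := by obtain ⟨M, rfl⟩ := h; exact M.pentagon
  triangle := by obtain ⟨M, rfl⟩ := h; exact M.triangle

end Monoidal

/-! ## Rigidity -/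

section Rigid

variable {C : Type u} [Category.{v} C] [MonoidalCategory C] [MonoidalClosed C]

/-- The dual `Hom(X, 1)`. -/
abbrev dualObj (X : C) : C := (ihom X).obj (𝟙_ C)

/-- The evaluation `X ⊗ Xᵛ ⟶ 1`. -/
abbrev dualEv (X : C) : X ⊗ dualObj X ⟶ 𝟙_ C := (ihom.ev X).app (𝟙_ C)

/-- The transpose of a morphism. -/
abbrev dualMap {X Y : C} (f : X ⟶ Y) : dualObj Y ⟶ dualObj X :=
  (MonoidalClosed.pre f).app (𝟙_ C)

variable [SymmetricCategory C]

/-- The canonical map from an object to its bidual. -/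
def toBidual (X : C) : X ⟶ dualObj (dualObj X) :=
  MonoidalClosed.curry ((β_ (dualObj X) X).hom ≫ dualEv X)

/-- The canonical map `Hom(X₁, Y₁) ⊗ Hom(X₂, Y₂) ⟶ Hom(X₁ ⊗ X₂, Y₁ ⊗ Y₂)`. -/
def ihomTensor (X₁ X₂ Y₁ Y₂ : C) :
    (ihom X₁).obj Y₁ ⊗ (ihom X₂).obj Y₂ ⟶ (ihom (X₁ ⊗ X₂)).obj (Y₁ ⊗ Y₂) :=
  MonoidalClosed.curry
    (tensorμ X₁ X₂ ((ihom X₁).obj Y₁) ((ihom X₂).obj Y₂) ≫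
      ((ihom.ev X₁).app Y₁ ⊗ₘ (ihom.ev X₂).app Y₂))

variable (C) in
/-- A closed symmetric monoidal category is rigid if every object is reflexive and internal homs
are compatible with the tensor product. -/
structure IsRigid : Prop where
  reflexive (X : C) : IsIso (toBidual X)
  isIso_ihomTensor (X₁ X₂ Y₁ Y₂ : C) : IsIso (ihomTensor X₁ X₂ Y₁ Y₂)

end Rigid

section Dual

variable {C : Type u} [Category.{v} C] [Abelian C] [MonoidalCategory C] [MonoidalPreadditive C]
  [MonoidalClosed C]

theorem dualMap_comp_eq_zero {X Y Z : C} (f : X ⟶ Y) (g : Y ⟶ Z) (h : f ≫ g = 0) :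
    dualMap g ≫ dualMap f = 0 := by
  apply MonoidalClosed.uncurry_injective
  rw [MonoidalClosed.uncurry_natural_left, MonoidalClosed.uncurry_pre, whisker_exchange_assoc,
    ← MonoidalClosed.uncurry_eq, MonoidalClosed.uncurry_pre, ← comp_whiskerRight_assoc, h,
    MonoidalPreadditive.zero_whiskerRight, zero_comp, MonoidalClosed.uncurry_eq,
    MonoidalPreadditive.whiskerLeft_zero, zero_comp]

/-- Exactness of the dual sequence `0 ⟶ Xᵛ ⟶ E₁ᵛ ⟶ Xᵛ ⟶ 0`, whose maps are the transposes of the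
projection and of the inclusion of `E`. -/
def SelfExtension.DualExact {X : C} (E : SelfExtension X) : Prop :=
  (ShortComplex.mk (dualMap E.proj) (dualMap E.incl)
    (dualMap_comp_eq_zero _ _ E.zero)).ShortExact

/-- The dual exact sequence. -/
abbrev SelfExtension.dual {X : C} (E : SelfExtension X) (h : E.DualExact) :
    SelfExtension (dualObj X) where
  mid := dualObj E.mid
  incl := dualMap E.proj
  proj := dualMap E.incl
  zero := dualMap_comp_eq_zero _ _ E.zero
  shortExact := h

abbrev Prolongation.dual (A : Prolongation C) (h : A.ext.DualExact) : Prolongation C where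
  base := dualObj A.base
  ext := A.ext.dual h

end Dual

end

/-!
The middle term `A₁` of an object `A` is a module over the dual numbers, `ε` acting as `i π`, and
`(A ⊗ B)₁` is the tensor product over the dual numbers: the canonical map `A₁ ⊗ B₁ ⟶ (A ⊗ B)₁` is
an epimorphism, and in terms of it each constraint of `𝔻(C)` is given by the one of `C` between
middle terms. Hence the axioms of a symmetric monoidal category for `𝔻(C)` follow from those
for `C`.

`(A ⊗ B)₁` is both the cokernel and the kernel of `1 ⊗ ε - ε ⊗ 1` on `A₁ ⊗ B₁`, so the evaluation
and the coevaluation of `A₁` descend to morphisms `A ⊗ Aᵛ ⟶ 1` and `1 ⟶ Aᵛ ⊗ A` over those of `A₀`.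
Their zigzag composites lie over identities, hence are isomorphisms because `Π₀` reflects
isomorphisms, and correcting the coevaluation makes `Aᵛ` a dual of `A`. So `𝔻(C)` is closed with
`Hom(A, B) = Aᵛ ⊗ B`, `Π₀` preserves internal homs, and rigidity descends along `Π₀`.
-/

noncomputable section

section Whisker

variable {C : Type*} [Category* C] [MonoidalCategory C] {X Y : C}

instance epi_whiskerLeft (Z : C) (f : X ⟶ Y) [Epi f] [(tensorLeft Z).PreservesEpimorphisms] :
    Epi (Z ◁ f) :=
  inferInstanceAs (Epi ((tensorLeft Z).map f))

instance epi_whiskerRight (f : X ⟶ Y) [Epi f] (Z : C) [(tensorRight Z).PreservesEpimorphisms] :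
    Epi (f ▷ Z) :=
  inferInstanceAs (Epi ((tensorRight Z).map f))

instance mono_whiskerLeft (Z : C) (f : X ⟶ Y) [Mono f] [(tensorLeft Z).PreservesMonomorphisms] :
    Mono (Z ◁ f) :=
  inferInstanceAs (Mono ((tensorLeft Z).map f))

instance mono_whiskerRight (f : X ⟶ Y) [Mono f] (Z : C)
    [(tensorRight Z).PreservesMonomorphisms] : Mono (f ▷ Z) :=
  inferInstanceAs (Mono ((tensorRight Z).map f))

end Whisker

section Zigzag

variable {D : Type*} [Category* D] [MonoidalCategory D] {A B : D}

/-- The composite `A ⟶ A ⊗ (B ⊗ A) ≅ (A ⊗ B) ⊗ A ⟶ A` of a candidate coevaluation `c` and a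
candidate evaluation `e`; it is the identity if `e` and `c` exhibit `B` as a dual of `A`. -/
def zigzagLeft (e : A ⊗ B ⟶ 𝟙_ D) (c : 𝟙_ D ⟶ B ⊗ A) : A ⟶ A :=
  (ρ_ A).inv ≫ A ◁ c ≫ (α_ A B A).inv ≫ e ▷ A ≫ (λ_ A).hom

/-- The composite `B ⟶ (B ⊗ A) ⊗ B ≅ B ⊗ (A ⊗ B) ⟶ B` of a candidate coevaluation `c` and a
candidate evaluation `e`; it is the identity if `e` and `c` exhibit `B` as a dual of `A`. -/
def zigzagRight (e : A ⊗ B ⟶ 𝟙_ D) (c : 𝟙_ D ⟶ B ⊗ A) : B ⟶ B :=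
  (λ_ B).inv ≫ c ▷ B ≫ (α_ B A B).hom ≫ B ◁ e ≫ (ρ_ B).hom

theorem whiskerLeft_zigzagRight_comp (e : A ⊗ B ⟶ 𝟙_ D) (c : 𝟙_ D ⟶ B ⊗ A) :
    A ◁ zigzagRight e c ≫ e = zigzagLeft e c ▷ B ≫ e := by
  unfold zigzagLeft zigzagRight
  calc
    _ = 𝟙 _ ⊗≫ A ◁ c ▷ B ⊗≫ ((A ⊗ B) ◁ e ≫ e ▷ 𝟙_ D) ⊗≫ 𝟙 _ := by monoidal
    _ = 𝟙 _ ⊗≫ A ◁ c ▷ B ⊗≫ (e ▷ (A ⊗ B) ≫ 𝟙_ D ◁ e) ⊗≫ 𝟙 _ := by rw [whisker_exchange]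
    _ = _ := by monoidal

theorem zigzagLeft_comp (e : A ⊗ B ⟶ 𝟙_ D) (c : 𝟙_ D ⟶ B ⊗ A) {A' : D} (f : A ⟶ A') :
    zigzagLeft e c ≫ f =
      (ρ_ A).inv ≫ A ◁ (c ≫ B ◁ f) ≫ (α_ A B A').inv ≫ e ▷ A' ≫ (λ_ A').hom := by
  simp only [zigzagLeft, Category.assoc]
  rw [← MonoidalCategory.leftUnitor_naturality, ← whisker_exchange_assoc]
  simp

theorem comp_zigzagRight (e : A ⊗ B ⟶ 𝟙_ D) (c : 𝟙_ D ⟶ B ⊗ A) {B' : D} (g : B' ⟶ B) :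
    g ≫ zigzagRight e c =
      (λ_ B').inv ≫ c ▷ B' ≫ (α_ B A B').hom ≫ B ◁ (A ◁ g ≫ e) ≫ (ρ_ B).hom := by
  unfold zigzagRight
  rw [leftUnitor_inv_naturality_assoc, whisker_exchange_assoc]
  simp

/-- The duality given by an evaluation and a coevaluation whose zigzags are identities. -/
abbrev exactPairingOfZigzag (e : A ⊗ B ⟶ 𝟙_ D) (c : 𝟙_ D ⟶ B ⊗ A)
    (hl : zigzagLeft e c = 𝟙 A) (hr : zigzagRight e c = 𝟙 B) : ExactPairing B A where
  coevaluation' := c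
  evaluation' := e
  coevaluation_evaluation' := by
    rw [← Iso.inv_comp_eq, ← cancel_mono (λ_ A).hom]
    simpa [zigzagLeft] using hl
  evaluation_coevaluation' := by
    rw [← Iso.inv_comp_eq, ← cancel_mono (ρ_ B).hom]
    simpa [zigzagRight] using hr

theorem exists_exactPairing_of_isIso_zigzag (e : A ⊗ B ⟶ 𝟙_ D) (c : 𝟙_ D ⟶ B ⊗ A)
    [IsIso (zigzagLeft e c)] [IsIso (zigzagRight e c)] :
    ∃ p : ExactPairing B A, p.evaluation' = e := by
  let c' := c ≫ B ◁ inv (zigzagLeft e c)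
  have hl : zigzagLeft e c' = 𝟙 A := by
    rw [← IsIso.hom_inv_id (zigzagLeft e c), zigzagLeft_comp, zigzagLeft]
  have hr : zigzagRight e c' = 𝟙 B := by
    have he : A ◁ inv (zigzagRight e c) ≫ e = inv (zigzagLeft e c) ▷ B ≫ e := by
      rw [← cancel_epi (zigzagLeft e c ▷ B), ← comp_whiskerRight_assoc, IsIso.hom_inv_id,
        ← whisker_exchange_assoc, ← whiskerLeft_zigzagRight_comp, ← whiskerLeft_comp_assoc,
        IsIso.inv_hom_id, id_whiskerRight, whiskerLeft_id]
    rw [← IsIso.inv_hom_id (zigzagRight e c), comp_zigzagRight, he]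
    simp [c', zigzagRight]
  exact ⟨exactPairingOfZigzag e c' hl hr, rfl⟩

section Functor

open Functor.LaxMonoidal Functor.OplaxMonoidal

variable {D' : Type*} [Category* D'] [MonoidalCategory D'] (F : D ⥤ D') [F.Monoidal]

theorem map_zigzagLeft (e : A ⊗ B ⟶ 𝟙_ D) (c : 𝟙_ D ⟶ B ⊗ A) :
    F.map (zigzagLeft e c) = zigzagLeft (μ F A B ≫ F.map e ≫ η F) (ε F ≫ F.map c ≫ δ F B A) := by
  simp only [zigzagLeft, Functor.map_comp, Functor.Monoidal.map_whiskerLeft,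
    Functor.Monoidal.map_whiskerRight, Functor.Monoidal.map_rightUnitor_inv,
    Functor.Monoidal.map_leftUnitor, Functor.Monoidal.map_associator_inv, comp_whiskerRight,
    whiskerLeft_comp, Category.assoc, Functor.Monoidal.μ_δ_assoc]

theorem map_zigzagRight (e : A ⊗ B ⟶ 𝟙_ D) (c : 𝟙_ D ⟶ B ⊗ A) :
    F.map (zigzagRight e c) =
      zigzagRight (μ F A B ≫ F.map e ≫ η F) (ε F ≫ F.map c ≫ δ F B A) := by
  simp only [zigzagRight, Functor.map_comp, Functor.Monoidal.map_whiskerLeft,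
    Functor.Monoidal.map_whiskerRight, Functor.Monoidal.map_leftUnitor_inv,
    Functor.Monoidal.map_rightUnitor, Functor.Monoidal.map_associator, comp_whiskerRight,
    whiskerLeft_comp, Category.assoc, Functor.Monoidal.μ_δ_assoc]

/-- Only the evaluation is kept: the coevaluation has to be corrected by an automorphism. -/
theorem exists_exactPairing_of_map [F.ReflectsIsomorphisms] (e : A ⊗ B ⟶ 𝟙_ D)
    (c : 𝟙_ D ⟶ B ⊗ A)
    (hl : zigzagLeft (μ F A B ≫ F.map e ≫ η F) (ε F ≫ F.map c ≫ δ F B A) = 𝟙 (F.obj A))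
    (hr : zigzagRight (μ F A B ≫ F.map e ≫ η F) (ε F ≫ F.map c ≫ δ F B A) = 𝟙 (F.obj B)) :
    ∃ p : ExactPairing B A, p.evaluation' = e := by
  have : IsIso (F.map (zigzagLeft e c)) := by rw [map_zigzagLeft, hl]; infer_instance
  have : IsIso (F.map (zigzagRight e c)) := by rw [map_zigzagRight, hr]; infer_instance
  have := isIso_of_reflects_iso (zigzagLeft e c) F
  have := isIso_of_reflects_iso (zigzagRight e c) F
  exact exists_exactPairing_of_isIso_zigzag e c

end Functor

end Zigzag

section Rigid

open MonoidalClosed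

variable {C : Type*} [Category* C] [MonoidalCategory C] [MonoidalClosed C]

theorem isIso_curry_leftUnitor (Y : C) : IsIso (curry (λ_ Y).hom) := by
  have : curry (λ_ Y).hom = unitNatIso.hom.app Y := by
    simp [unitNatIso]
    rfl
  rw [this]
  infer_instance

instance isIso_pre {X Y : C} (f : X ⟶ Y) [IsIso f] : IsIso (pre f) :=
  have : IsIso ((tensoringLeft C).map f) := inferInstance
  conjugateEquiv_iso _ _ _

theorem curry_dualEv (X : C) : curry (dualEv X) = 𝟙 (dualObj X) := by
  rw [dualEv, ← uncurry_id_eq_ev, curry_uncurry]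

theorem whiskerLeft_dualMap_comp_dualEv {X Y : C} (f : X ⟶ Y) :
    X ◁ dualMap f ≫ dualEv X = f ▷ dualObj Y ≫ dualEv Y :=
  id_tensor_pre_app_comp_ev f (𝟙_ C)

theorem dualMap_comp {X Y Z : C} (f : X ⟶ Y) (g : Y ⟶ Z) :
    dualMap (f ≫ g) = dualMap g ≫ dualMap f := by
  rw [dualMap, pre_map, NatTrans.comp_app]

theorem uncurry_comp_dualMap {X Y T : C} (f : X ⟶ Y) (x : T ⟶ dualObj Y) :
    uncurry (x ≫ dualMap f) = f ▷ T ≫ uncurry x :=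
  uncurry_pre_app ..

theorem mono_dualMap [∀ T : C, (tensorRight T).PreservesEpimorphisms] {X Y : C} (f : X ⟶ Y)
    [Epi f] : Mono (dualMap f) where
  right_cancellation {T} x y hxy := by
    apply uncurry_injective
    rw [← cancel_epi (f ▷ T), ← uncurry_comp_dualMap, hxy, uncurry_comp_dualMap]

/-- The canonical map `Xᵛ ⊗ Y ⟶ Hom(X, Y)`. -/
def dualTensor (X Y : C) : dualObj X ⊗ Y ⟶ (ihom X).obj Y :=
  curry ((α_ X (dualObj X) Y).inv ≫ dualEv X ▷ Y ≫ (λ_ Y).hom)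

theorem uncurry_comp_dualTensor {X Y T : C} (t : T ⟶ dualObj X ⊗ Y) :
    uncurry (t ≫ dualTensor X Y) =
      X ◁ t ≫ (α_ X (dualObj X) Y).inv ≫ dualEv X ▷ Y ≫ (λ_ Y).hom := by
  rw [uncurry_natural_left, dualTensor, uncurry_curry]

theorem dualTensor_naturality_right (X : C) {Y Y' : C} (g : Y ⟶ Y') :
    dualObj X ◁ g ≫ dualTensor X Y' = dualTensor X Y ≫ (ihom X).map g := by
  apply uncurry_injective
  rw [uncurry_comp_dualTensor, uncurry_natural_right, dualTensor, uncurry_curry,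
    associator_inv_naturality_right_assoc, whisker_exchange_assoc]
  simp

theorem dualTensor_naturality_left {X X' : C} (f : X ⟶ X') (Y : C) :
    dualMap f ▷ Y ≫ dualTensor X Y = dualTensor X' Y ≫ (pre f).app Y := by
  apply uncurry_injective
  rw [uncurry_comp_dualTensor, uncurry_pre_app, dualTensor, uncurry_curry,
    associator_inv_naturality_middle_assoc, ← comp_whiskerRight_assoc,
    whiskerLeft_dualMap_comp_dualEv, comp_whiskerRight_assoc, associator_inv_naturality_left_assoc]

variable [SymmetricCategory C]

theorem dualTensor_eq (X Y : C) :
    dualTensor X Y = dualObj X ◁ curry (λ_ Y).hom ≫ ihomTensor X (𝟙_ C) (𝟙_ C) Y ≫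
      (pre (ρ_ X).inv).app _ ≫ (ihom X).map (λ_ Y).hom := by
  apply uncurry_injective
  rw [dualTensor, uncurry_curry, uncurry_natural_left, uncurry_natural_left, uncurry_natural_right,
    uncurry_pre, ihomTensor, Category.assoc, whisker_exchange_assoc]
  rw [← Category.assoc (_ ◁ curry _), ← uncurry_eq, uncurry_curry, whisker_exchange_assoc,
    ← id_tensorHom (dualObj X), Category.assoc, tensorμ_natural_right_assoc, whiskerLeft_id,
    tensorHom_comp_tensorHom_assoc, Category.id_comp, whiskerLeft_curry_ihom_ev_app]
  simp only [tensorμ, braiding_tensorUnit_left, MonoidalCategory.tensorHom_def]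
  monoidal

theorem toBidual_naturality {X Y : C} (f : X ⟶ Y) :
    f ≫ toBidual Y = toBidual X ≫ dualMap (dualMap f) := by
  apply uncurry_injective
  rw [uncurry_comp_dualMap, toBidual, toBidual, uncurry_natural_left, uncurry_curry, uncurry_curry,
    BraidedCategory.braiding_naturality_right_assoc,
    BraidedCategory.braiding_naturality_left_assoc, whiskerLeft_dualMap_comp_dualEv]

namespace IsRigid

theorem isIso_dualTensor (h : IsRigid C) (X Y : C) : IsIso (dualTensor X Y) := by
  have := h.isIso_ihomTensor X (𝟙_ C) (𝟙_ C) Y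
  have := isIso_curry_leftUnitor Y
  rw [dualTensor_eq]
  infer_instance

/-- The coevaluation of an object of a rigid category: the element of `Xᵛ ⊗ X` corresponding to
the identity under `Xᵛ ⊗ X ≅ Hom(X, X)`. -/
def coev (h : IsRigid C) (X : C) : 𝟙_ C ⟶ dualObj X ⊗ X :=
  haveI := h.isIso_dualTensor X X
  curry (ρ_ X).hom ≫ inv (dualTensor X X)

theorem coev_comp_dualTensor (h : IsRigid C) (X : C) :
    h.coev X ≫ dualTensor X X = curry (ρ_ X).hom := by
  simp [coev]

theorem zigzagLeft_eq (h : IsRigid C) (X : C) : zigzagLeft (dualEv X) (h.coev X) = 𝟙 X := by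
  have := congrArg uncurry (h.coev_comp_dualTensor X)
  rw [uncurry_comp_dualTensor, uncurry_curry] at this
  rw [zigzagLeft, this, Iso.inv_hom_id]

theorem zigzagRight_eq (h : IsRigid C) (X : C) :
    zigzagRight (dualEv X) (h.coev X) = 𝟙 (dualObj X) := by
  apply uncurry_injective
  rw [uncurry_eq, uncurry_id_eq_ev, whiskerLeft_zigzagRight_comp, h.zigzagLeft_eq, id_whiskerRight,
    Category.id_comp]

theorem coev_comp_whiskerLeft (h : IsRigid C) {X Y : C} (f : X ⟶ Y) :
    h.coev X ≫ dualObj X ◁ f = h.coev Y ≫ dualMap f ▷ Y := by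
  have := h.isIso_dualTensor X Y
  rw [← cancel_mono (dualTensor X Y), Category.assoc, Category.assoc, dualTensor_naturality_right,
    dualTensor_naturality_left, reassoc_of% h.coev_comp_dualTensor X,
    reassoc_of% h.coev_comp_dualTensor Y, ← curry_natural_right, curry_pre_app,
    rightUnitor_naturality]

theorem mono_dualMap_dualMap (h : IsRigid C) {X Y : C} (f : X ⟶ Y) [Mono f] :
    Mono (dualMap (dualMap f)) := by
  have := h.reflexive X
  have := h.reflexive Y
  rw [← (IsIso.inv_comp_eq (toBidual X)).2 (toBidual_naturality f)]
  infer_instance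

end IsRigid

end Rigid

section RigidAbelian

variable {C : Type*} [Category* C] [Abelian C] [MonoidalCategory C] [MonoidalPreadditive C]
  [MonoidalClosed C]

theorem dualMap_zero (X Y : C) : dualMap (0 : X ⟶ Y) = 0 := by
  simpa using dualMap_comp_eq_zero (0 : X ⟶ Y) (𝟙 Y) zero_comp

namespace IsRigid

variable [SymmetricCategory C]

theorem eq_zero_of_dualMap_eq_zero (h : IsRigid C) {X Y : C} {f : X ⟶ Y} (hf : dualMap f = 0) :
    f = 0 := by
  have := h.reflexive Y
  rw [← cancel_mono (toBidual Y), toBidual_naturality, hf, dualMap_zero, comp_zero, zero_comp]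

theorem epi_dualMap (h : IsRigid C) {X Y : C} (f : X ⟶ Y) [Mono f] : Epi (dualMap f) := by
  have := h.mono_dualMap_dualMap f
  refine Preadditive.epi_of_cancel_zero _ fun g hg => h.eq_zero_of_dualMap_eq_zero ?_
  rw [← cancel_mono (dualMap (dualMap f)), ← dualMap_comp, hg, dualMap_zero, zero_comp]

end IsRigid

end RigidAbelian

section RigidTransfer

open MonoidalClosed Functor.LaxMonoidal Functor.OplaxMonoidal

variable {C D : Type*} [Category* C] [MonoidalCategory C] [Category* D] [MonoidalCategory D]

theorem whiskerLeft_μ_comp_map_tensorμ [BraidedCategory C] [BraidedCategory D] (F : D ⥤ C)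
    [F.LaxBraided] {X₁ X₂ H₁ H₂ Y₁ Y₂ : D} (e₁ : X₁ ⊗ H₁ ⟶ Y₁)
    (e₂ : X₂ ⊗ H₂ ⟶ Y₂) :
    (F.obj X₁ ⊗ F.obj X₂) ◁ μ F H₁ H₂ ≫ μ F X₁ X₂ ▷ F.obj (H₁ ⊗ H₂) ≫
        μ F (X₁ ⊗ X₂) (H₁ ⊗ H₂) ≫ F.map (tensorμ X₁ X₂ H₁ H₂ ≫ (e₁ ⊗ₘ e₂)) =
      tensorμ (F.obj X₁) (F.obj X₂) (F.obj H₁) (F.obj H₂) ≫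
        (μ F X₁ H₁ ≫ F.map e₁ ⊗ₘ μ F X₂ H₂ ≫ F.map e₂) ≫ μ F Y₁ Y₂ := by
  rw [← tensorHom_comp_tensorHom_assoc, μ_natural, tensorμ_comp_μ_tensorHom_μ_comp_μ_assoc,
    F.map_comp, tensorHom_def' (μ F X₁ X₂), Category.assoc]

variable [MonoidalClosed C] [MonoidalClosed D]

/-- The canonical map `F Hom(A, B) ⟶ Hom(F A, F B)` of a lax monoidal functor `F`. -/
def ihomComparison (F : D ⥤ C) [F.LaxMonoidal] (A B : D) :
    F.obj ((ihom A).obj B) ⟶ (ihom (F.obj A)).obj (F.obj B) :=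
  curry (μ F A ((ihom A).obj B) ≫ F.map ((ihom.ev A).app B))

theorem whiskerLeft_ihomComparison_comp_ev (F : D ⥤ C) [F.LaxMonoidal] (A B : D) :
    F.obj A ◁ ihomComparison F A B ≫ (ihom.ev (F.obj A)).app (F.obj B) =
      μ F A ((ihom A).obj B) ≫ F.map ((ihom.ev A).app B) :=
  whiskerLeft_curry_ihom_ev_app ..

theorem map_curry_comp_ihomComparison (F : D ⥤ C) [F.LaxMonoidal] {A B T : D} (f : A ⊗ T ⟶ B) :
    F.map (curry f) ≫ ihomComparison F A B = curry (μ F A T ≫ F.map f) := by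
  rw [ihomComparison, ← curry_natural_left, μ_natural_right_assoc, ← F.map_comp,
    whiskerLeft_curry_ihom_ev_app]

theorem isIso_curry_of_map (F : D ⥤ C) [F.LaxMonoidal] [F.ReflectsIsomorphisms] {A B T : D}
    (f : A ⊗ T ⟶ B) [IsIso (ihomComparison F A B)] [IsIso (curry (μ F A T ≫ F.map f))] :
    IsIso (curry f) := by
  have : IsIso (F.map (curry f) ≫ ihomComparison F A B) := by
    rwa [map_curry_comp_ihomComparison]
  have := IsIso.of_isIso_comp_right (F.map (curry f)) (ihomComparison F A B)
  exact isIso_of_reflects_iso (curry f) F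

/-- The canonical map `F Aᵛ ⟶ (F A)ᵛ` of a monoidal functor `F`. -/
def dualComparison (F : D ⥤ C) [F.Monoidal] (A : D) : F.obj (dualObj A) ⟶ dualObj (F.obj A) :=
  ihomComparison F A (𝟙_ D) ≫ (ihom (F.obj A)).map (η F)

theorem whiskerLeft_dualComparison_comp_dualEv (F : D ⥤ C) [F.Monoidal] (A : D) :
    F.obj A ◁ dualComparison F A ≫ dualEv (F.obj A) =
      μ F A (dualObj A) ≫ F.map (dualEv A) ≫ η F := by
  rw [← uncurry_eq, dualComparison, uncurry_natural_right, uncurry_eq,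
    whiskerLeft_ihomComparison_comp_ev, Category.assoc]

variable [SymmetricCategory C] [SymmetricCategory D] (F : D ⥤ C) [F.Braided]

theorem map_toBidual_comp_dualComparison (A : D) :
    F.map (toBidual A) ≫ dualComparison F (dualObj A) =
      toBidual (F.obj A) ≫ dualMap (dualComparison F A) := by
  apply uncurry_injective
  rw [dualComparison, toBidual, reassoc_of% map_curry_comp_ihomComparison F, uncurry_natural_right,
    uncurry_curry, uncurry_comp_dualMap, toBidual, uncurry_curry, F.map_comp, Category.assoc,
    Category.assoc, Functor.LaxBraided.braided_assoc,
    BraidedCategory.braiding_naturality_left_assoc, whiskerLeft_dualComparison_comp_dualEv]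

theorem map_ihomTensor_comp_ihomComparison (X₁ X₂ Y₁ Y₂ : D) :
    μ F ((ihom X₁).obj Y₁) ((ihom X₂).obj Y₂) ≫
        (F.map (ihomTensor X₁ X₂ Y₁ Y₂) ≫ ihomComparison F (X₁ ⊗ X₂) (Y₁ ⊗ Y₂)) ≫
          (pre (μ F X₁ X₂)).app _ =
      (ihomComparison F X₁ Y₁ ⊗ₘ ihomComparison F X₂ Y₂) ≫
        ihomTensor (F.obj X₁) (F.obj X₂) (F.obj Y₁) (F.obj Y₂) ≫
          (ihom (F.obj X₁ ⊗ F.obj X₂)).map (μ F Y₁ Y₂) := by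
  apply uncurry_injective
  rw [ihomTensor, map_curry_comp_ihomComparison, uncurry_natural_left, uncurry_pre_app,
    uncurry_curry, uncurry_natural_left, uncurry_natural_right, ihomTensor, uncurry_curry,
    Category.assoc, tensorμ_natural_right_assoc, tensorHom_comp_tensorHom_assoc,
    whiskerLeft_ihomComparison_comp_ev, whiskerLeft_ihomComparison_comp_ev]
  exact whiskerLeft_μ_comp_map_tensorμ F _ _

theorem isRigid_of_isIso_ihomComparison [F.ReflectsIsomorphisms] (h : IsRigid C)
    (hF : ∀ A B : D, IsIso (ihomComparison F A B)) : IsRigid D where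
  reflexive A := by
    have (A : D) : IsIso (dualComparison F A) := by unfold dualComparison; infer_instance
    have := h.reflexive (F.obj A)
    have : IsIso (F.map (toBidual A) ≫ dualComparison F (dualObj A)) := by
      rw [map_toBidual_comp_dualComparison]
      infer_instance
    have := IsIso.of_isIso_comp_right (F.map (toBidual A)) (dualComparison F (dualObj A))
    exact isIso_of_reflects_iso (toBidual A) F
  isIso_ihomTensor X₁ X₂ Y₁ Y₂ := by
    have := h.isIso_ihomTensor (F.obj X₁) (F.obj X₂) (F.obj Y₁) (F.obj Y₂)
    let t := F.map (ihomTensor X₁ X₂ Y₁ Y₂) ≫ ihomComparison F (X₁ ⊗ X₂) (Y₁ ⊗ Y₂)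
    have : IsIso (μ F ((ihom X₁).obj Y₁) ((ihom X₂).obj Y₂) ≫ t ≫ (pre (μ F X₁ X₂)).app _) := by
      rw [map_ihomTensor_comp_ihomComparison]
      infer_instance
    have : IsIso (t ≫ (pre (μ F X₁ X₂)).app _) := IsIso.of_isIso_comp_left (μ F _ _) _
    have : IsIso t := IsIso.of_isIso_comp_right t ((pre (μ F X₁ X₂)).app _)
    have := IsIso.of_isIso_comp_right (F.map (ihomTensor X₁ X₂ Y₁ Y₂)) (ihomComparison F _ _)
    exact isIso_of_reflects_iso (ihomTensor X₁ X₂ Y₁ Y₂) F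

end RigidTransfer

namespace SelfExtension

section YonedaSum

variable {C : Type u} [Category.{v} C] [Abelian C] {X Y : C}

theorem sumMk_sumMap {f : X ⟶ Y} {E F : SelfExtension X} {E' F' : SelfExtension Y}
    (m : HomOver f E E') (n : HomOver f F F') {T : C} (a : T ⟶ E.mid) (b : T ⟶ F.mid)
    (h : a ≫ E.proj = b ≫ F.proj) :
    sumMk E F a b h ≫ (sumMap m n).mid = sumMk E' F' (a ≫ m.mid) (b ≫ n.mid)
      (by simp [m.mid_proj, n.mid_proj, reassoc_of% h]) := by
  rw [sumMk_desc, comp_sumMk]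
  exact sumMk_congr _ _ _ (pullback.lift_fst_assoc ..) (pullback.lift_snd_assoc ..)

theorem sumMk_sumSwap (E F : SelfExtension X) {T : C} (a : T ⟶ E.mid) (b : T ⟶ F.mid)
    (h : a ≫ E.proj = b ≫ F.proj) :
    sumMk E F a b h ≫ (sumSwap E F).mid = sumMk F E b a h.symm := by
  rw [sumMk_desc, comp_sumMk]
  exact sumMk_congr _ _ _ (pullback.lift_snd ..) (pullback.lift_fst ..)

theorem sumMk_splitSum (E : SelfExtension X) {T : C} (x : T ⟶ X ⊞ X) (a : T ⟶ E.mid)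
    (h : x ≫ biprod.snd = a ≫ E.proj) :
    sumMk (split X) E x a h ≫ (splitSum E).mid = x ≫ biprod.fst ≫ E.incl + a := by
  rw [sumMk_desc, Preadditive.comp_add, pullback.lift_fst_assoc, pullback.lift_snd]

theorem sumMk_sumSplit (E : SelfExtension X) {T : C} (a : T ⟶ E.mid) (x : T ⟶ X ⊞ X)
    (h : a ≫ E.proj = x ≫ biprod.snd) :
    sumMk E (split X) a x h ≫ (sumSplit E).mid = a + x ≫ biprod.fst ≫ E.incl := by
  rw [sumMk_desc, Preadditive.comp_add, pullback.lift_fst, pullback.lift_snd_assoc]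

section Assoc

variable (E F G : SelfExtension X) {T : C} (a : T ⟶ E.mid) (b : T ⟶ F.mid) (c : T ⟶ G.mid)
  (hab : a ≫ E.proj = b ≫ F.proj) (hac : a ≫ E.proj = c ≫ G.proj)

/-- The map to the triple fibre product given by three compatible maps. -/
abbrev tripleLift : T ⟶ triple E F G :=
  pullback.lift (pullback.lift a b hab) c (by rw [pullback.lift_fst_assoc, hac])

theorem tripleLift_leftBracket :
    tripleLift E F G a b c hab hac ≫ leftBracket E F G =
      sumMk (yonedaSum E F) G (sumMk E F a b hab) c (by rw [sumMk_proj, hac]) := by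
  rw [leftBracket, comp_sumMk]
  refine sumMk_congr _ _ _ ?_ (pullback.lift_snd ..)
  rw [comp_sumMk]
  exact sumMk_congr _ _ _ (by rw [pullback.lift_fst_assoc, pullback.lift_fst])
    (by rw [pullback.lift_fst_assoc, pullback.lift_snd])

theorem tripleLift_rightBracket :
    tripleLift E F G a b c hab hac ≫ rightBracket E F G =
      sumMk E (yonedaSum F G) a (sumMk F G b c (by rw [← hab, hac])) (by rw [sumMk_proj, hab]) := by
  rw [rightBracket, comp_sumMk]
  refine sumMk_congr _ _ _ (by rw [pullback.lift_fst_assoc, pullback.lift_fst]) ?_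
  rw [comp_sumMk]
  exact sumMk_congr _ _ _ (by rw [pullback.lift_fst_assoc, pullback.lift_snd])
    (pullback.lift_snd ..)

theorem sumMk_sumAssoc :
    sumMk (yonedaSum E F) G (sumMk E F a b hab) c (by rw [sumMk_proj, hac]) ≫
        (sumAssoc E F G).mid =
      sumMk E (yonedaSum F G) a (sumMk F G b c (by rw [← hab, hac])) (by rw [sumMk_proj, hab]) := by
  rw [← tripleLift_leftBracket E F G a b c hab hac, Category.assoc, Abelian.comp_epiDesc,
    tripleLift_rightBracket]

end Assoc

end YonedaSum

section Tensor

variable {C : Type u} [Category.{v} C] [Abelian C] [MonoidalCategory C] [MonoidalPreadditive C]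
  [∀ X : C, PreservesFiniteLimits (tensorLeft X)]
  [∀ X : C, PreservesFiniteColimits (tensorLeft X)] {X Y : C}

theorem whiskerLeft_incl_proj (Z : C) (E : SelfExtension X) : Z ◁ E.incl ≫ Z ◁ E.proj = 0 :=
  (tensorL Z E).zero

theorem whiskerLeft_sumMk (Z : C) (E F : SelfExtension X) {T : C} (a : T ⟶ E.mid) (b : T ⟶ F.mid)
    (h : a ≫ E.proj = b ≫ F.proj) :
    Z ◁ sumMk E F a b h =
      sumMk (tensorL Z E) (tensorL Z F) (Z ◁ a) (Z ◁ b)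
          (by rw [← whiskerLeft_comp, h, whiskerLeft_comp]) ≫
        (sumTensorL Z E F).mid :=
  map_sumMk (tensorLeft Z) E F a b h

variable [SymmetricCategory C]

theorem incl_proj_whiskerRight (E : SelfExtension X) (Z : C) : E.incl ▷ Z ≫ E.proj ▷ Z = 0 :=
  (E.tensorR Z).zero

theorem sumMk_whiskerRight (E F : SelfExtension X) {T : C} (a : T ⟶ E.mid) (b : T ⟶ F.mid)
    (h : a ≫ E.proj = b ≫ F.proj) (Z : C) :
    sumMk E F a b h ▷ Z =
      sumMk (E.tensorR Z) (F.tensorR Z) (a ▷ Z) (b ▷ Z)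
          (by rw [← comp_whiskerRight, h, comp_whiskerRight]) ≫
        (sumTensorR E F Z).mid :=
  map_sumMk (tensorRight Z) E F a b h

end Tensor

end SelfExtension

namespace Prolongation

open SelfExtension

section Category

variable {C : Type u} [Category.{v} C] [Abelian C]

theorem id_mid (A : Prolongation C) : (𝟙 A : A ⟶ A).ext.mid = 𝟙 A.ext.mid := rfl

theorem comp_mid {A B D : Prolongation C} (f : A ⟶ B) (g : B ⟶ D) :
    (f ≫ g).ext.mid = f.ext.mid ≫ g.ext.mid := rfl

theorem hom_ext_mid {A B : Prolongation C} {f g : A ⟶ B} (h : f.ext.mid = g.ext.mid) : f = g := by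
  refine hom_ext ?_ h
  rw [← cancel_epi A.ext.proj, ← f.ext.mid_proj, ← g.ext.mid_proj, h]

instance reflectsIsomorphisms_Pi₀ : (Pi₀ C).ReflectsIsomorphisms where
  reflects f hf :=
    have : IsIso f.base := hf
    (isoOver (asIso f.base) f.ext).isIso_hom

end Category

variable {C : Type u} [Category.{v} C] [Abelian C] [MonoidalCategory C] [MonoidalPreadditive C]
  [SymmetricCategory C]
  [∀ X : C, PreservesFiniteLimits (tensorLeft X)]
  [∀ X : C, PreservesFiniteColimits (tensorLeft X)]

section TensorMid

theorem comp_tensorMid {A B : Prolongation C} {T : C} (x : T ⟶ A.ext.mid ⊗ B.ext.mid) :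
    x ≫ tensorMid A B = sumMk (A.ext.tensorR B.base) (tensorL A.base B.ext)
      (x ≫ A.ext.mid ◁ B.ext.proj) (x ≫ A.ext.proj ▷ B.ext.mid)
      (by simp [whisker_exchange]) :=
  comp_sumMk ..

theorem tensorMid_proj (A B : Prolongation C) :
    tensorMid A B ≫ (tensorObj A B).ext.proj = A.ext.mid ◁ B.ext.proj ≫ A.ext.proj ▷ B.base :=
  sumMk_proj _ _ _ _ _

instance epi_tensorMid (A B : Prolongation C) : Epi (tensorMid A B) := by
  rw [epi_iff_surjective_up_to_refinements]
  intro T x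
  obtain ⟨T₁, t₁, _, a, b, h, e⟩ :=
    exists_sumMk (A.ext.tensorR B.base) (tensorL A.base B.ext) x
  obtain ⟨T₂, t₂, _, y, hy⟩ := surjective_up_to_refinements_of_epi (A.ext.mid ◁ B.ext.proj) a
  have hz : (t₂ ≫ b - y ≫ A.ext.proj ▷ B.ext.mid) ≫ A.base ◁ B.ext.proj = 0 := by
    rw [Preadditive.sub_comp, Category.assoc, Category.assoc, ← whisker_exchange,
      ← reassoc_of% hy, ← h, sub_self]
  obtain ⟨w, hw⟩ := (tensorL A.base B.ext).exists_lift _ hz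
  obtain ⟨T₃, t₃, _, v, hv⟩ := surjective_up_to_refinements_of_epi (A.ext.proj ▷ B.base) w
  refine ⟨T₃, t₃ ≫ t₂ ≫ t₁, inferInstance, t₃ ≫ y + v ≫ A.ext.mid ◁ B.ext.incl, ?_⟩
  rw [Category.assoc, Category.assoc, e, comp_tensorMid, comp_sumMk, comp_sumMk]
  apply sumMk_congr
  · rw [Preadditive.add_comp, Category.assoc, Category.assoc, whiskerLeft_incl_proj, comp_zero,
      add_zero, hy]
  · rw [Preadditive.add_comp, Category.assoc, Category.assoc, whisker_exchange,
      ← reassoc_of% hv, ← hw, Preadditive.comp_sub, add_sub_cancel]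

theorem tensorMid_tensorHom {A B A' B' : Prolongation C} (f : A ⟶ A') (g : B ⟶ B') :
    tensorMid A B ≫ (tensorHom f g).ext.mid = (f.ext.mid ⊗ₘ g.ext.mid) ≫ tensorMid A' B' := by
  rw [comp_tensorMid, tensorMid, sumMk_sumMap]
  apply sumMk_congr
  · rw [HomOver.tensorR_mid, MonoidalCategory.tensorHom_def, MonoidalCategory.tensorHom_def,
      Category.assoc, ← whiskerLeft_comp, g.ext.mid_proj, whiskerLeft_comp, whisker_exchange_assoc]
  · rw [HomOver.tensorL_mid, MonoidalCategory.tensorHom_def', MonoidalCategory.tensorHom_def',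
      Category.assoc, ← comp_whiskerRight, f.ext.mid_proj, comp_whiskerRight,
      whisker_exchange_assoc]

theorem tensorMid_tensorHom_id {A A' : Prolongation C} (f : A ⟶ A') (B : Prolongation C) :
    tensorMid A B ≫ (tensorHom f (𝟙 B)).ext.mid = f.ext.mid ▷ B.ext.mid ≫ tensorMid A' B := by
  rw [tensorMid_tensorHom, id_mid, tensorHom_id]

theorem tensorMid_id_tensorHom (A : Prolongation C) {B B' : Prolongation C} (g : B ⟶ B') :
    tensorMid A B ≫ (tensorHom (𝟙 A) g).ext.mid = A.ext.mid ◁ g.ext.mid ≫ tensorMid A B' := by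
  rw [tensorMid_tensorHom, id_mid, id_tensorHom]

theorem tensorMid_braiding (A B : Prolongation C) :
    tensorMid A B ≫ (braiding A B).hom.ext.mid =
      (β_ A.ext.mid B.ext.mid).hom ≫ tensorMid B A := by
  rw [comp_tensorMid, tensorMid]
  change sumMk _ _ _ _ _ ≫ (sumMap _ _).mid ≫ (sumSwap _ _).mid = _
  rw [← Category.assoc, sumMk_sumMap, sumMk_sumSwap]
  exact sumMk_congr _ _ _ (BraidedCategory.braiding_naturality_left ..)
    (BraidedCategory.braiding_naturality_right ..)

theorem tensorMid_leftUnitor (A : Prolongation C) :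
    tensorMid (unit C) A ≫ (leftUnitor A).hom.ext.mid =
      biprod.fst ▷ A.ext.mid ≫ (λ_ _).hom ≫ A.ext.proj ≫ A.ext.incl +
        biprod.snd ▷ A.ext.mid ≫ (λ_ _).hom := by
  rw [tensorMid]
  change sumMk _ _ _ _ _ ≫ (sumMap _ _).mid ≫ (splitSum _).mid = _
  rw [← Category.assoc, sumMk_sumMap, sumMk_splitSum]
  simp [whisker_exchange_assoc]

theorem tensorMid_rightUnitor (A : Prolongation C) :
    tensorMid A (unit C) ≫ (rightUnitor A).hom.ext.mid =
      A.ext.mid ◁ biprod.snd ≫ (ρ_ _).hom +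
        A.ext.mid ◁ biprod.fst ≫ (ρ_ _).hom ≫ A.ext.proj ≫ A.ext.incl := by
  rw [tensorMid]
  change sumMk _ _ _ _ _ ≫ (sumMap _ _).mid ≫ (sumSplit _).mid = _
  rw [← Category.assoc, sumMk_sumMap, sumMk_sumSplit]
  simp [← whisker_exchange_assoc]

theorem whiskerLeft_proj_incl_tensorMid (A B : Prolongation C) :
    A.ext.mid ◁ (B.ext.proj ≫ B.ext.incl) ≫ tensorMid A B =
      (A.ext.proj ≫ A.ext.incl) ▷ B.ext.mid ≫ tensorMid A B := by
  rw [comp_tensorMid, comp_tensorMid, sumMk_eq_iff]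
  refine ⟨-(A.ext.mid ◁ B.ext.proj ≫ A.ext.proj ▷ B.base), ?_, ?_⟩
  · simp [whiskerLeft_incl_proj, whisker_exchange]
  · simp [incl_proj_whiskerRight, whisker_exchange, whisker_exchange_assoc]

end TensorMid

section Associator

variable (A B D : Prolongation C)

theorem sumMk_associator {T : C}
    {a : T ⟶ (A.ext.mid ⊗ B.base) ⊗ D.base} {a' : T ⟶ A.ext.mid ⊗ (B.base ⊗ D.base)}
    {b : T ⟶ (A.base ⊗ B.ext.mid) ⊗ D.base} {b' : T ⟶ A.base ⊗ (B.ext.mid ⊗ D.base)}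
    {c : T ⟶ (A.base ⊗ B.base) ⊗ D.ext.mid} {c' : T ⟶ A.base ⊗ (B.base ⊗ D.ext.mid)}
    {x : T ⟶ (tensorObj A B).ext.mid ⊗ D.base} {y : T ⟶ A.base ⊗ (tensorObj B D).ext.mid}
    (ha : a ≫ (α_ _ _ _).hom = a') (hb : b ≫ (α_ _ _ _).hom = b') (hc : c ≫ (α_ _ _ _).hom = c')
    (hab : a ≫ A.ext.proj ▷ B.base ▷ D.base = b ≫ (A.base ◁ B.ext.proj) ▷ D.base)
    (hbc : b' ≫ A.base ◁ B.ext.proj ▷ D.base = c' ≫ A.base ◁ B.base ◁ D.ext.proj)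
    (hx : x = sumMk ((A.ext.tensorR B.base).tensorR D.base)
      ((tensorL A.base B.ext).tensorR D.base) a b hab ≫
        (sumTensorR (A.ext.tensorR B.base) (tensorL A.base B.ext) D.base).mid)
    (hy : y = sumMk (tensorL A.base (B.ext.tensorR D.base)) (tensorL A.base (tensorL B.base D.ext))
      b' c' hbc ≫ (sumTensorL A.base (B.ext.tensorR D.base) (tensorL B.base D.ext)).mid)
    (hxc : x ≫ (tensorObj A B).ext.proj ▷ D.base = c ≫ (A.base ⊗ B.base) ◁ D.ext.proj)
    (hay : a' ≫ A.ext.proj ▷ (B.base ⊗ D.base) = y ≫ A.base ◁ (tensorObj B D).ext.proj) :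
    sumMk ((tensorObj A B).ext.tensorR D.base) (tensorL (A.base ⊗ B.base) D.ext) x c hxc ≫
        (associator A B D).hom.ext.mid =
      sumMk (A.ext.tensorR (B.base ⊗ D.base)) (tensorL A.base (tensorObj B D).ext) a' y hay := by
  subst ha hb hc
  have hac : a ≫ A.ext.proj ▷ B.base ▷ D.base = c ≫ (A.base ⊗ B.base) ◁ D.ext.proj := by
    simpa only [Category.assoc, ← associator_naturality_middle, ← associator_naturality_right,
      ← reassoc_of% hab, Iso.cancel_iso_hom_right_assoc] using hbc
  let m := sumTensorR (A.ext.tensorR B.base) (tensorL A.base B.ext) D.base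
  have hm : x ≫ (HomOver.symm (f := Iso.refl _) m).mid = sumMk _ _ a b hab := by
    have := m.isIso_mid
    exact (IsIso.comp_inv_eq m.mid).mpr hx
  change _ ≫ (((sumMap (HomOver.symm (f := Iso.refl _) m) _).mid ≫ (sumAssoc _ _ _).mid) ≫
    (sumMap _ _).mid) ≫ (sumMap _ _).mid = _
  rw [Category.assoc, Category.assoc, ← Category.assoc, sumMk_sumMap,
    sumMk_congr _ _ _ hm (Category.comp_id c), ← Category.assoc,
    sumMk_sumAssoc _ _ _ _ _ _ hab hac, ← Category.assoc, sumMk_sumMap, sumMk_sumMap]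
  refine sumMk_congr _ _ _ (Category.comp_id _) ?_
  rw [sumMk_sumMap, hy]
  rfl

theorem tensorMid_associator :
    tensorMid A B ▷ D.ext.mid ≫ tensorMid (tensorObj A B) D ≫ (associator A B D).hom.ext.mid =
      (α_ _ _ _).hom ≫ A.ext.mid ◁ tensorMid B D ≫ tensorMid A (tensorObj B D) := by
  rw [← Category.assoc, ← Category.assoc (Iso.hom _), comp_tensorMid, comp_tensorMid]
  refine sumMk_associator A B D
    (a := (A.ext.mid ⊗ B.ext.mid) ◁ D.ext.proj ≫ (A.ext.mid ◁ B.ext.proj) ▷ D.base)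
    (b := (A.ext.mid ⊗ B.ext.mid) ◁ D.ext.proj ≫ (A.ext.proj ▷ B.ext.mid) ▷ D.base)
    (b' := ((α_ _ _ _).hom ≫ A.ext.proj ▷ _) ≫ A.base ◁ B.ext.mid ◁ D.ext.proj)
    (c' := ((α_ _ _ _).hom ≫ A.ext.proj ▷ _) ≫ A.base ◁ B.ext.proj ▷ D.ext.mid)
    ?_ ?_ ?_ ?_ ?_ ?_ ?_ _ _
  · rw [Category.assoc (Iso.hom _), ← whiskerLeft_comp, tensorMid_proj]
    simp
  · rw [whisker_exchange (A.ext.proj ▷ B.ext.mid) D.ext.proj]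
    simp
  · rw [← comp_whiskerRight, tensorMid_proj, whisker_exchange]
    simp
  · rw [Category.assoc, Category.assoc, ← comp_whiskerRight, ← comp_whiskerRight,
      whisker_exchange A.ext.proj B.ext.proj]
  · simp only [Category.assoc, ← whiskerLeft_comp, whisker_exchange]
  · rw [← whisker_exchange, tensorMid, sumMk_whiskerRight, ← Category.assoc, comp_sumMk]
  · rw [Category.assoc, whisker_exchange, tensorMid, whiskerLeft_sumMk, ← Category.assoc,
      ← Category.assoc, comp_sumMk]

end Associator
end Prolongation

namespace Prolongation

open SelfExtension Functor.LaxMonoidal Functor.OplaxMonoidal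

variable {C : Type u} [Category.{v} C] [Abelian C] [MonoidalCategory C] [MonoidalPreadditive C]
  [SymmetricCategory C]
  [∀ X : C, PreservesFiniteLimits (tensorLeft X)]
  [∀ X : C, PreservesFiniteColimits (tensorLeft X)]

theorem hom_ext_tensorMid {A B X : Prolongation C} {f g : tensorObj A B ⟶ X}
    (h : tensorMid A B ≫ f.ext.mid = tensorMid A B ≫ g.ext.mid) : f = g :=
  hom_ext_mid ((cancel_epi _).mp h)

theorem hom_ext_tensorMid_whiskerRight {A B D X : Prolongation C}
    {f g : tensorObj (tensorObj A B) D ⟶ X}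
    (h : tensorMid A B ▷ D.ext.mid ≫ tensorMid (tensorObj A B) D ≫ f.ext.mid =
      tensorMid A B ▷ D.ext.mid ≫ tensorMid (tensorObj A B) D ≫ g.ext.mid) : f = g :=
  hom_ext_tensorMid ((cancel_epi _).mp h)

section Monoidal

theorem tensorHom_eq {A B A' B' : Prolongation C} (f : A ⟶ A') (g : B ⟶ B') :
    tensorHom f g = tensorHom f (𝟙 B) ≫ tensorHom (𝟙 A') g := by
  apply hom_ext_tensorMid
  rw [comp_mid, reassoc_of% tensorMid_tensorHom_id, tensorMid_id_tensorHom, tensorMid_tensorHom,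
    MonoidalCategory.tensorHom_def, Category.assoc]

theorem tensorHom_id_id (A B : Prolongation C) : tensorHom (𝟙 A) (𝟙 B) = 𝟙 (tensorObj A B) := by
  apply hom_ext_tensorMid
  rw [tensorMid_id_tensorHom, id_mid, id_mid, whiskerLeft_id, Category.id_comp, Category.comp_id]

theorem tensorHom_comp {A B A' B' A'' B'' : Prolongation C} (f : A ⟶ A') (g : B ⟶ B')
    (f' : A' ⟶ A'') (g' : B' ⟶ B'') :
    tensorHom f g ≫ tensorHom f' g' = tensorHom (f ≫ f') (g ≫ g') := by
  apply hom_ext_tensorMid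
  rw [comp_mid, reassoc_of% tensorMid_tensorHom, tensorMid_tensorHom, tensorMid_tensorHom,
    tensorHom_comp_tensorHom_assoc, comp_mid, comp_mid]

theorem tensorMid_whiskerRight_tensorMid_tensorHom {A B D A' B' D' : Prolongation C} (f : A ⟶ A')
    (g : B ⟶ B') (h : D ⟶ D') :
    tensorMid A B ▷ D.ext.mid ≫ tensorMid (tensorObj A B) D ≫
        (tensorHom (tensorHom f g) h).ext.mid =
      ((f.ext.mid ⊗ₘ g.ext.mid) ⊗ₘ h.ext.mid) ≫
        tensorMid A' B' ▷ D'.ext.mid ≫ tensorMid (tensorObj A' B') D' := by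
  rw [tensorMid_tensorHom, ← tensorHom_id, tensorHom_comp_tensorHom_assoc, tensorMid_tensorHom,
    ← tensorHom_id, tensorHom_comp_tensorHom_assoc, Category.id_comp, Category.comp_id]

theorem whiskerLeft_tensorMid_tensorMid_tensorHom {A B D A' B' D' : Prolongation C} (f : A ⟶ A')
    (g : B ⟶ B') (h : D ⟶ D') :
    A.ext.mid ◁ tensorMid B D ≫ tensorMid A (tensorObj B D) ≫
        (tensorHom f (tensorHom g h)).ext.mid =
      (f.ext.mid ⊗ₘ (g.ext.mid ⊗ₘ h.ext.mid)) ≫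
        A'.ext.mid ◁ tensorMid B' D' ≫ tensorMid A' (tensorObj B' D') := by
  rw [tensorMid_tensorHom, ← id_tensorHom, tensorHom_comp_tensorHom_assoc, tensorMid_tensorHom,
    ← id_tensorHom, tensorHom_comp_tensorHom_assoc, Category.id_comp, Category.comp_id]

theorem associator_naturality {A B D A' B' D' : Prolongation C} (f : A ⟶ A') (g : B ⟶ B')
    (h : D ⟶ D') :
    tensorHom (tensorHom f g) h ≫ (associator A' B' D').hom =
      (associator A B D).hom ≫ tensorHom f (tensorHom g h) := by
  apply hom_ext_tensorMid_whiskerRight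
  rw [comp_mid, comp_mid, reassoc_of% tensorMid_whiskerRight_tensorMid_tensorHom,
    tensorMid_associator, reassoc_of% tensorMid_associator,
    whiskerLeft_tensorMid_tensorMid_tensorHom, MonoidalCategory.associator_naturality_assoc]

theorem pentagon (A B D E : Prolongation C) :
    tensorHom (associator A B D).hom (𝟙 E) ≫ (associator A (tensorObj B D) E).hom ≫
        tensorHom (𝟙 A) (associator B D E).hom =
      (associator (tensorObj A B) D E).hom ≫ (associator A B (tensorObj D E)).hom := by
  have h_right : tensorMid A B ▷ D.ext.mid ▷ E.ext.mid ≫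
      tensorMid (tensorObj A B) D ▷ E.ext.mid ≫ (associator A B D).hom.ext.mid ▷ E.ext.mid =
      (α_ _ _ _).hom ▷ E.ext.mid ≫ (A.ext.mid ◁ tensorMid B D) ▷ E.ext.mid ≫
        tensorMid A (tensorObj B D) ▷ E.ext.mid := by
    simpa only [comp_whiskerRight] using
      congrArg (· ▷ E.ext.mid) (tensorMid_associator A B D)
  have h_left : A.ext.mid ◁ tensorMid B D ▷ E.ext.mid ≫
      A.ext.mid ◁ tensorMid (tensorObj B D) E ≫ A.ext.mid ◁ (associator B D E).hom.ext.mid =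
      A.ext.mid ◁ (α_ _ _ _).hom ≫ A.ext.mid ◁ B.ext.mid ◁ tensorMid D E ≫
        A.ext.mid ◁ tensorMid B (tensorObj D E) := by
    simpa only [whiskerLeft_comp] using
      congrArg (A.ext.mid ◁ ·) (tensorMid_associator B D E)
  apply hom_ext_tensorMid_whiskerRight
  rw [← cancel_epi (tensorMid A B ▷ D.ext.mid ▷ E.ext.mid), comp_mid, comp_mid, comp_mid,
    reassoc_of% tensorMid_tensorHom_id, reassoc_of% h_right, reassoc_of% tensorMid_associator,
    tensorMid_id_tensorHom, reassoc_of% tensorMid_associator, associator_naturality_left_assoc,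
    ← whisker_exchange_assoc, tensorMid_associator A B (tensorObj D E)]
  simp only [associator_naturality_middle_assoc, associator_naturality_right_assoc,
    reassoc_of% h_left, MonoidalCategory.pentagon_assoc]

theorem leftUnitor_naturality {A B : Prolongation C} (f : A ⟶ B) :
    tensorHom (𝟙 (unit C)) f ≫ (leftUnitor B).hom = (leftUnitor A).hom ≫ f := by
  apply hom_ext_tensorMid
  rw [comp_mid, comp_mid, reassoc_of% tensorMid_id_tensorHom, tensorMid_leftUnitor,
    reassoc_of% tensorMid_leftUnitor]
  simp only [Preadditive.add_comp, Preadditive.comp_add, Category.assoc, f.ext.incl_mid,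
    whisker_exchange_assoc, leftUnitor_naturality_assoc, MonoidalCategory.leftUnitor_naturality,
    reassoc_of% f.ext.mid_proj]

theorem rightUnitor_naturality {A B : Prolongation C} (f : A ⟶ B) :
    tensorHom f (𝟙 (unit C)) ≫ (rightUnitor B).hom = (rightUnitor A).hom ≫ f := by
  apply hom_ext_tensorMid
  rw [comp_mid, comp_mid, reassoc_of% tensorMid_tensorHom_id, tensorMid_rightUnitor,
    reassoc_of% tensorMid_rightUnitor]
  simp only [Preadditive.add_comp, Preadditive.comp_add, Category.assoc, f.ext.incl_mid,
    ← whisker_exchange_assoc, rightUnitor_naturality_assoc,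
    MonoidalCategory.rightUnitor_naturality, reassoc_of% f.ext.mid_proj]

theorem triangle (A B : Prolongation C) :
    (associator A (unit C) B).hom ≫ tensorHom (𝟙 A) (leftUnitor B).hom =
      tensorHom (rightUnitor A).hom (𝟙 B) := by
  have h_eps : A.ext.mid ◁ B.ext.proj ≫ A.ext.mid ◁ B.ext.incl ≫ tensorMid A B =
      A.ext.proj ▷ B.ext.mid ≫ A.ext.incl ▷ B.ext.mid ≫ tensorMid A B := by
    simpa only [whiskerLeft_comp, comp_whiskerRight, Category.assoc] using
      whiskerLeft_proj_incl_tensorMid A B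
  apply hom_ext_tensorMid_whiskerRight
  rw [comp_mid, reassoc_of% tensorMid_associator, tensorMid_id_tensorHom, tensorMid_tensorHom_id,
    ← whiskerLeft_comp_assoc, ← comp_whiskerRight_assoc, tensorMid_leftUnitor,
    tensorMid_rightUnitor]
  simp only [MonoidalPreadditive.whiskerLeft_add, MonoidalPreadditive.add_whiskerRight,
    Preadditive.add_comp, Preadditive.comp_add]
  rw [add_comm]
  congr 1
  · simp
  · simp only [whiskerLeft_comp, comp_whiskerRight, Category.assoc]
    rw [h_eps]
    simp

variable (C) in
/-- The monoidal structure on the prolongation. -/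
abbrev monoidalCategory : MonoidalCategory (Prolongation C) where
  __ := tensorStruct
  tensorHom_def := tensorHom_eq
  id_tensorHom_id := tensorHom_id_id
  tensorHom_comp_tensorHom := tensorHom_comp
  whiskerLeft_id := tensorHom_id_id
  id_whiskerRight := tensorHom_id_id
  associator_naturality := associator_naturality
  leftUnitor_naturality := leftUnitor_naturality
  rightUnitor_naturality := rightUnitor_naturality
  pentagon := pentagon
  triangle := triangle

end Monoidal

attribute [local instance] monoidalCategory

section Symmetric

theorem hexagon (A B D : Prolongation C) :
    (associator A B D).hom ≫ (braiding A (tensorObj B D)).hom ≫ (associator B D A).hom =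
      tensorHom (braiding A B).hom (𝟙 D) ≫ (associator B A D).hom ≫
        tensorHom (𝟙 B) (braiding A D).hom := by
  apply hom_ext_tensorMid_whiskerRight
  rw [comp_mid, comp_mid, comp_mid, comp_mid, reassoc_of% tensorMid_associator,
    reassoc_of% tensorMid_braiding, reassoc_of% tensorMid_tensorHom_id,
    ← comp_whiskerRight_assoc, tensorMid_braiding, comp_whiskerRight_assoc,
    reassoc_of% tensorMid_associator, tensorMid_id_tensorHom, ← whiskerLeft_comp_assoc,
    tensorMid_braiding, whiskerLeft_comp_assoc, BraidedCategory.braiding_naturality_right_assoc,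
    tensorMid_associator, BraidedCategory.hexagon_forward_assoc]

theorem braiding_naturality {A B A' B' : Prolongation C} (f : A ⟶ A') (g : B ⟶ B') :
    tensorHom f g ≫ (braiding A' B').hom = (braiding A B).hom ≫ tensorHom g f := by
  apply hom_ext_tensorMid
  rw [comp_mid, comp_mid, reassoc_of% tensorMid_tensorHom, tensorMid_braiding,
    reassoc_of% tensorMid_braiding, tensorMid_tensorHom, BraidedCategory.braiding_naturality_assoc]

theorem braiding_braiding (A B : Prolongation C) :
    (braiding A B).hom ≫ (braiding B A).hom = 𝟙 _ := by
  apply hom_ext_tensorMid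
  rw [comp_mid, reassoc_of% tensorMid_braiding, tensorMid_braiding,
    SymmetricCategory.symmetry_assoc, id_mid, Category.comp_id]

theorem hexagon_inv (A B D : Prolongation C) :
    (associator A B D).inv ≫ (braiding (tensorObj A B) D).hom ≫ (associator D A B).inv =
      tensorHom (𝟙 A) (braiding B D).hom ≫ (associator A D B).inv ≫
        tensorHom (braiding A D).hom (𝟙 B) := by
  have inv_braiding (A B : Prolongation C) : (braiding A B).inv = (braiding B A).hom :=
    Iso.inv_ext (braiding_braiding A B)
  have h : α_ D A B ≪≫ braiding D (tensorObj A B) ≪≫ α_ A B D =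
      whiskerRightIso (braiding D A) B ≪≫ α_ A D B ≪≫ whiskerLeftIso A (braiding D B) :=
    Iso.ext (hexagon D A B)
  have h_inv := congrArg Iso.inv h
  simp only [Iso.trans_inv, whiskerRightIso_inv, whiskerLeftIso_inv, Category.assoc,
    inv_braiding] at h_inv
  exact h_inv

variable (C) in
/-- The symmetric structure on the prolongation. -/
abbrev symmetricCategory : SymmetricCategory (Prolongation C) where
  braiding := braiding
  braiding_naturality_right A _ _ f := braiding_naturality (𝟙 A) f
  braiding_naturality_left f B := braiding_naturality f (𝟙 B)
  hexagon_forward := hexagon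
  hexagon_reverse := hexagon_inv
  symmetry := braiding_braiding

attribute [local instance] symmetricCategory

variable (C) in
/-- The symmetric monoidal structure of `Π₀`, given by identities. -/
abbrev braidedPi₀ : (Pi₀ C).Braided where
  toMonoidal := Functor.CoreMonoidal.toMonoidal
    { εIso := Iso.refl _
      μIso := fun A B => Iso.refl (A.base ⊗ B.base)
      μIso_hom_natural_left := fun f B => by
        change f.base ▷ B.base ≫ 𝟙 _ = 𝟙 _ ≫ (f.base ⊗ₘ 𝟙 B.base)
        simp
      μIso_hom_natural_right := fun A f => by
        change A.base ◁ f.base ≫ 𝟙 _ = 𝟙 _ ≫ (𝟙 A.base ⊗ₘ f.base)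
        simp
      associativity := fun A B D => by
        change 𝟙 (A.base ⊗ B.base) ▷ D.base ≫ 𝟙 _ ≫ (α_ A.base B.base D.base).hom =
          (α_ A.base B.base D.base).hom ≫ A.base ◁ 𝟙 (B.base ⊗ D.base) ≫ 𝟙 _
        simp
      left_unitality := fun A => by
        change (λ_ A.base).hom = 𝟙 (𝟙_ C) ▷ A.base ≫ 𝟙 _ ≫ (λ_ A.base).hom
        simp
      right_unitality := fun A => by
        change (ρ_ A.base).hom = A.base ◁ 𝟙 (𝟙_ C) ≫ 𝟙 _ ≫ (ρ_ A.base).hom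
        simp }
  braided A B := by
    change 𝟙 _ ≫ (β_ A.base B.base).hom = (β_ A.base B.base).hom ≫ 𝟙 _
    simp

attribute [local instance] braidedPi₀

theorem μ_comp_Pi₀_map_comp_η {A B : Prolongation C} (e : A ⊗ B ⟶ 𝟙_ (Prolongation C)) :
    μ (Pi₀ C) A B ≫ (Pi₀ C).map e ≫ η (Pi₀ C) = e.base := by
  change 𝟙 _ ≫ e.base ≫ 𝟙 _ = e.base
  rw [Category.id_comp, Category.comp_id]

theorem ε_comp_Pi₀_map_comp_δ {A B : Prolongation C} (c : 𝟙_ (Prolongation C) ⟶ A ⊗ B) :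
    ε (Pi₀ C) ≫ (Pi₀ C).map c ≫ δ (Pi₀ C) A B = c.base := by
  change 𝟙 _ ≫ c.base ≫ 𝟙 _ = c.base
  rw [Category.id_comp, Category.comp_id]

end Symmetric

end Prolongation

namespace SelfExtension

variable {C : Type u} [Category.{v} C] [Abelian C] [MonoidalCategory C] [MonoidalPreadditive C]
  [SymmetricCategory C]
  [∀ X : C, PreservesFiniteLimits (tensorLeft X)]
  [∀ X : C, PreservesFiniteColimits (tensorLeft X)]

theorem exists_lift_of_proj_eq_zero {X Y T : C} (E : SelfExtension X) (F : SelfExtension Y)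
    (x : T ⟶ E.mid ⊗ F.mid) (h₁ : x ≫ E.mid ◁ F.proj = 0) (h₂ : x ≫ E.proj ▷ F.mid = 0) :
    ∃ w : T ⟶ X ⊗ Y, x = w ≫ E.incl ▷ Y ≫ E.mid ◁ F.incl := by
  obtain ⟨y, rfl⟩ := (tensorL E.mid F).exists_lift x h₁
  have hy : y ≫ E.proj ▷ Y = 0 := by
    rw [← cancel_mono (X ◁ F.incl), zero_comp, Category.assoc, ← whisker_exchange,
      ← Category.assoc]
    exact h₂
  obtain ⟨z, rfl⟩ := (E.tensorR Y).exists_lift y hy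
  exact ⟨z, Category.assoc _ _ _⟩

end SelfExtension

namespace Prolongation

open SelfExtension

section Balance

variable {C : Type u} [Category.{v} C] [Abelian C] [MonoidalCategory C] [MonoidalPreadditive C]

/-- The difference `1 ⊗ ε - ε ⊗ 1` of the two actions on `A₁ ⊗ B₁` of the dual numbers, where
`ε = i π` on `A₁` and on `B₁`. Its cokernel and its kernel are both `(A ⊗ B)₁`. -/
def balance (A B : Prolongation C) : A.ext.mid ⊗ B.ext.mid ⟶ A.ext.mid ⊗ B.ext.mid :=
  A.ext.mid ◁ (B.ext.proj ≫ B.ext.incl) - (A.ext.proj ≫ A.ext.incl) ▷ B.ext.mid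

theorem incl_whiskerRight_balance (A B : Prolongation C) :
    A.ext.incl ▷ B.ext.mid ≫ balance A B =
      A.base ◁ B.ext.proj ≫ A.ext.incl ▷ B.base ≫ A.ext.mid ◁ B.ext.incl := by
  rw [balance, Preadditive.comp_sub, ← comp_whiskerRight, reassoc_of% A.ext.zero, zero_comp,
    MonoidalPreadditive.zero_whiskerRight, sub_zero, whiskerLeft_comp, whisker_exchange_assoc]

theorem whiskerLeft_incl_balance (A B : Prolongation C) :
    A.ext.mid ◁ B.ext.incl ≫ balance A B =
      -(A.ext.proj ▷ B.base ≫ A.ext.incl ▷ B.base ≫ A.ext.mid ◁ B.ext.incl) := by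
  rw [balance, Preadditive.comp_sub, ← whiskerLeft_comp, reassoc_of% B.ext.zero, zero_comp,
    MonoidalPreadditive.whiskerLeft_zero, zero_sub, whisker_exchange, comp_whiskerRight,
    Category.assoc]

theorem balance_whiskerLeft_proj (A B : Prolongation C) :
    balance A B ≫ A.ext.mid ◁ B.ext.proj =
      -(A.ext.mid ◁ B.ext.proj ≫ A.ext.proj ▷ B.base ≫ A.ext.incl ▷ B.base) := by
  rw [balance, Preadditive.sub_comp, ← whiskerLeft_comp, Category.assoc, B.ext.zero, comp_zero,
    MonoidalPreadditive.whiskerLeft_zero, zero_sub, ← whisker_exchange, comp_whiskerRight]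

theorem balance_proj_whiskerRight (A B : Prolongation C) :
    balance A B ≫ A.ext.proj ▷ B.ext.mid =
      A.ext.mid ◁ B.ext.proj ≫ A.ext.proj ▷ B.base ≫ A.base ◁ B.ext.incl := by
  rw [balance, Preadditive.sub_comp, ← comp_whiskerRight, Category.assoc, A.ext.zero, comp_zero,
    MonoidalPreadditive.zero_whiskerRight, sub_zero, whiskerLeft_comp, Category.assoc,
    whisker_exchange]

end Balance

section Exactness

variable {C : Type u} [Category.{v} C] [Abelian C] [MonoidalCategory C] [MonoidalPreadditive C]
  [SymmetricCategory C]
  [∀ X : C, PreservesFiniteLimits (tensorLeft X)]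
  [∀ X : C, PreservesFiniteColimits (tensorLeft X)]

/-- The norm map `(A ⊗ B)₁ ⟶ A₁ ⊗ B₁`, `[(s, t)] ↦ (1 ⊗ i) s + (i ⊗ 1) t`. -/
def normMid (A B : Prolongation C) : (tensorObj A B).ext.mid ⟶ A.ext.mid ⊗ B.ext.mid :=
  sumDesc (A.ext.tensorR B.base) (tensorL A.base B.ext)
    (pullback.fst _ _ ≫ A.ext.mid ◁ B.ext.incl + pullback.snd _ _ ≫ A.ext.incl ▷ B.ext.mid)
    (by simp [antidiag, pullback.lift_fst_assoc, pullback.lift_snd_assoc, whisker_exchange])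

theorem whiskerLeft_proj_comp_tensor_incl (A B : Prolongation C) :
    A.base ◁ B.ext.proj ≫ (tensorObj A B).ext.incl = A.ext.incl ▷ B.ext.mid ≫ tensorMid A B := by
  change _ ≫ sumMk _ _ _ _ _ = _
  rw [comp_tensorMid, comp_sumMk]
  apply sumMk_congr
  · rw [whisker_exchange]
  · rw [incl_proj_whiskerRight, comp_zero]

theorem sumMk_normMid (A B : Prolongation C) {T : C} (a : T ⟶ A.ext.mid ⊗ B.base)
    (b : T ⟶ A.base ⊗ B.ext.mid) (h : a ≫ A.ext.proj ▷ B.base = b ≫ A.base ◁ B.ext.proj) :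
    sumMk (A.ext.tensorR B.base) (tensorL A.base B.ext) a b h ≫ normMid A B =
      a ≫ A.ext.mid ◁ B.ext.incl + b ≫ A.ext.incl ▷ B.ext.mid := by
  rw [normMid, sumMk_desc]
  simp [pullback.lift_fst_assoc, pullback.lift_snd_assoc]

theorem normMid_proj (A B : Prolongation C) :
    normMid A B ≫ A.ext.proj ▷ B.ext.mid = (tensorObj A B).ext.proj ≫ A.base ◁ B.ext.incl := by
  change _ = sumProj _ _ ≫ _
  rw [← cancel_epi (sumQuot _ _), ← Category.assoc, sumQuot_eq_mk, sumMk_normMid, ← Category.assoc,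
    sumMk_proj, Preadditive.add_comp, Category.assoc, Category.assoc, incl_proj_whiskerRight,
    comp_zero, add_zero, whisker_exchange]
  exact (Category.assoc _ _ _).symm

instance mono_normMid (A B : Prolongation C) : Mono (normMid A B) := by
  apply Preadditive.mono_of_cancel_zero
  intro T x hx
  obtain ⟨T', t, _, a, b, h, e⟩ := exists_sumMk _ _ x
  dsimp only at a b h
  have h_sum : a ≫ A.ext.mid ◁ B.ext.incl + b ≫ A.ext.incl ▷ B.ext.mid = 0 := by
    rw [← sumMk_normMid A B a b h, ← e, Category.assoc, hx, comp_zero]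
  have ha : a ≫ A.ext.proj ▷ B.base = 0 := by
    rw [← cancel_mono (A.base ◁ B.ext.incl), zero_comp, Category.assoc, ← whisker_exchange]
    simpa [incl_proj_whiskerRight] using congrArg (· ≫ A.ext.proj ▷ B.ext.mid) h_sum
  obtain ⟨w, rfl⟩ := (A.ext.tensorR B.base).exists_lift a ha
  rw [← cancel_epi t, comp_zero, e, sumMk_eq_zero_iff]
  refine ⟨w, rfl, ?_⟩
  rw [← cancel_mono (A.ext.incl ▷ B.ext.mid), Preadditive.neg_comp, Category.assoc,
    whisker_exchange, eq_neg_iff_add_eq_zero, add_comm, ← Category.assoc]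
  exact h_sum

theorem balance_comp_tensorMid (A B : Prolongation C) : balance A B ≫ tensorMid A B = 0 := by
  rw [balance, Preadditive.sub_comp, whiskerLeft_proj_incl_tensorMid, sub_self]

theorem normMid_comp_balance (A B : Prolongation C) : normMid A B ≫ balance A B = 0 := by
  rw [← cancel_epi (sumQuot _ _), ← Category.assoc, sumQuot_eq_mk, sumMk_normMid, comp_zero,
    Preadditive.add_comp, Category.assoc, Category.assoc, whiskerLeft_incl_balance,
    incl_whiskerRight_balance, Preadditive.comp_neg, neg_add_eq_zero, ← Category.assoc,
    ← Category.assoc (pullback.snd _ _)]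
  exact congrArg (· ≫ _) pullback.condition

theorem exact_balance_tensorMid (A B : Prolongation C) :
    (ShortComplex.mk _ _ (balance_comp_tensorMid A B)).Exact := by
  rw [ShortComplex.exact_iff_exact_up_to_refinements]
  intro T k hk
  dsimp only at k hk
  rw [comp_tensorMid, sumMk_eq_zero_iff] at hk
  obtain ⟨w, hw₁, hw₂⟩ := hk
  dsimp only at hw₁ hw₂
  obtain ⟨T', t, _, v, hv⟩ := surjective_up_to_refinements_of_epi
    (A.ext.mid ◁ B.ext.proj ≫ A.ext.proj ▷ B.base) w
  obtain ⟨u, hu⟩ := A.ext.exists_lift_of_proj_eq_zero B.ext (t ≫ k + v ≫ balance A B)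
    (by
      rw [Preadditive.add_comp, Category.assoc, Category.assoc, hw₁, balance_whiskerLeft_proj,
        reassoc_of% hv, Preadditive.comp_neg, add_neg_cancel])
    (by
      rw [Preadditive.add_comp, Category.assoc, Category.assoc, hw₂, balance_proj_whiskerRight,
        Preadditive.comp_neg, reassoc_of% hv, neg_add_cancel])
  obtain ⟨T'', t', _, u', hu'⟩ := surjective_up_to_refinements_of_epi (A.base ◁ B.ext.proj) u
  refine ⟨T'', t' ≫ t, inferInstance, u' ≫ A.ext.incl ▷ B.ext.mid - t' ≫ v, ?_⟩
  dsimp only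
  rw [Preadditive.sub_comp, Category.assoc u', incl_whiskerRight_balance, ← reassoc_of% hu', ← hu,
    Preadditive.comp_add, Category.assoc, Category.assoc, add_sub_cancel_right]

theorem exact_normMid_balance (A B : Prolongation C) :
    (ShortComplex.mk _ _ (normMid_comp_balance A B)).Exact := by
  rw [ShortComplex.exact_iff_exact_up_to_refinements]
  intro T x hx
  dsimp only at x hx
  have h_proj : (x ≫ A.ext.mid ◁ B.ext.proj) ≫ A.ext.proj ▷ B.base = 0 := by
    rw [← cancel_mono (A.base ◁ B.ext.incl), Category.assoc, Category.assoc,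
      ← balance_proj_whiskerRight, reassoc_of% hx, zero_comp, zero_comp]
  obtain ⟨z, hz⟩ := (A.ext.tensorR B.base).exists_lift _ h_proj
  dsimp only at hz
  have hz' : x ≫ A.ext.proj ▷ B.ext.mid = z ≫ A.base ◁ B.ext.incl := by
    rw [← cancel_mono (A.ext.incl ▷ B.ext.mid), Category.assoc, Category.assoc, whisker_exchange,
      ← reassoc_of% hz, ← whiskerLeft_comp, ← comp_whiskerRight, eq_comm, ← sub_eq_zero,
      ← Preadditive.comp_sub]
    exact hx
  obtain ⟨T', t, _, s, hs⟩ := surjective_up_to_refinements_of_epi (A.ext.proj ▷ B.base) z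
  obtain ⟨r, hr⟩ := (A.ext.tensorR B.ext.mid).exists_lift (t ≫ x - s ≫ A.ext.mid ◁ B.ext.incl) (by
    dsimp only
    rw [Preadditive.sub_comp, Category.assoc, Category.assoc, hz', whisker_exchange,
      reassoc_of% hs, sub_self])
  dsimp only at hr
  have hsr : s ≫ A.ext.proj ▷ B.base = r ≫ A.base ◁ B.ext.proj := by
    rw [← cancel_mono (A.ext.incl ▷ B.base), Category.assoc r, whisker_exchange,
      ← Category.assoc r, ← hr, Preadditive.sub_comp, Category.assoc t, hz, ← Category.assoc t,
      hs, Category.assoc s (_ ◁ _), whiskerLeft_incl_proj, comp_zero, sub_zero]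
  refine ⟨T', t, inferInstance, sumMk (A.ext.tensorR B.base) (tensorL A.base B.ext) s r hsr, ?_⟩
  dsimp only
  rw [sumMk_normMid, ← hr, add_sub_cancel]

/-- The map `(A ⊗ B)₁ ⟶ Z` induced by a map out of `A₁ ⊗ B₁` that is balanced over the dual
numbers. -/
def tensorMidDesc (A B : Prolongation C) {Z : C} (m : A.ext.mid ⊗ B.ext.mid ⟶ Z)
    (hm : balance A B ≫ m = 0) : (tensorObj A B).ext.mid ⟶ Z :=
  haveI : Epi (ShortComplex.mk _ _ (balance_comp_tensorMid A B)).g := epi_tensorMid A B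
  (exact_balance_tensorMid A B).desc m hm

theorem tensorMid_tensorMidDesc (A B : Prolongation C) {Z : C} (m : A.ext.mid ⊗ B.ext.mid ⟶ Z)
    (hm : balance A B ≫ m = 0) : tensorMid A B ≫ tensorMidDesc A B m hm = m :=
  haveI : Epi (ShortComplex.mk _ _ (balance_comp_tensorMid A B)).g := epi_tensorMid A B
  (exact_balance_tensorMid A B).g_desc m hm

/-- The map `T ⟶ (A ⊗ B)₁` given by a map to `A₁ ⊗ B₁` on whose image both actions of the dual
numbers agree. -/
def normMidLift (A B : Prolongation C) {T : C} (x : T ⟶ A.ext.mid ⊗ B.ext.mid)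
    (hx : x ≫ balance A B = 0) : T ⟶ (tensorObj A B).ext.mid :=
  haveI : Mono (ShortComplex.mk _ _ (normMid_comp_balance A B)).f := mono_normMid A B
  (exact_normMid_balance A B).lift x hx

theorem normMidLift_normMid (A B : Prolongation C) {T : C} (x : T ⟶ A.ext.mid ⊗ B.ext.mid)
    (hx : x ≫ balance A B = 0) : normMidLift A B x hx ≫ normMid A B = x :=
  haveI : Mono (ShortComplex.mk _ _ (normMid_comp_balance A B)).f := mono_normMid A B
  (exact_normMid_balance A B).lift_f x hx

end Exactness

end Prolongation

section DualExact

open MonoidalClosed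

variable {C : Type u} [Category.{v} C] [Abelian C] [MonoidalCategory C] [MonoidalPreadditive C]
  [SymmetricCategory C]
  [∀ X : C, PreservesFiniteLimits (tensorLeft X)]
  [∀ X : C, PreservesFiniteColimits (tensorLeft X)] [MonoidalClosed C]

theorem SelfExtension.exact_dualMap {X : C} (E : SelfExtension X) :
    (ShortComplex.mk (dualMap E.proj) (dualMap E.incl)
      (dualMap_comp_eq_zero _ _ E.zero)).Exact := by
  rw [ShortComplex.exact_iff_exact_up_to_refinements]
  intro T x hx
  dsimp only at x hx
  have hx' : E.incl ▷ T ≫ uncurry x = 0 := by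
    rw [← uncurry_comp_dualMap, hx, uncurry_eq, MonoidalPreadditive.whiskerLeft_zero, zero_comp]
  refine ⟨T, 𝟙 T, inferInstance, curry ((E.tensorR T).shortExact.exact.desc _ hx'), ?_⟩
  apply uncurry_injective
  rw [Category.id_comp, uncurry_comp_dualMap, uncurry_curry]
  exact ((E.tensorR T).shortExact.exact.g_desc _ hx').symm

theorem IsRigid.dualExact (h : IsRigid C) {X : C} (E : SelfExtension X) : E.DualExact where
  exact := E.exact_dualMap
  mono_f := mono_dualMap E.proj
  epi_g := h.epi_dualMap E.incl

end DualExact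

namespace Prolongation

open SelfExtension MonoidalClosed Functor.LaxMonoidal

section UnitHom

variable {C : Type u} [Category.{v} C] [Abelian C] [MonoidalCategory C]

/-- The morphism to the unit object with given first component `A₁ ⟶ 1`. -/
def toUnit (A : Prolongation C) (m : A.ext.mid ⟶ 𝟙_ C) : A ⟶ unit C where
  base := A.ext.incl ≫ m
  ext :=
    { mid := biprod.lift m (A.ext.proj ≫ A.ext.incl ≫ m)
      incl_mid := by
        apply biprod.hom_ext
        · simp
        · simp [reassoc_of% A.ext.zero]
      mid_proj := by simp }

/-- The morphism from the unit object with given second component `1 ⟶ A₁`. -/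
def ofUnit (A : Prolongation C) (y : 𝟙_ C ⟶ A.ext.mid) : unit C ⟶ A where
  base := y ≫ A.ext.proj
  ext :=
    { mid := biprod.desc (y ≫ A.ext.proj ≫ A.ext.incl) y
      incl_mid := by simp
      mid_proj := by
        apply biprod.hom_ext'
        · simp [A.ext.zero]
        · simp }

end UnitHom

variable {C : Type u} [Category.{v} C] [Abelian C] [MonoidalCategory C] [MonoidalPreadditive C]
  [MonoidalClosed C]

theorem balance_comp_dualEv (A : Prolongation C) (hA : A.ext.DualExact) :
    balance A (A.dual hA) ≫ dualEv A.ext.mid = 0 := by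
  rw [balance, Preadditive.sub_comp, ← dualMap_comp, whiskerLeft_dualMap_comp_dualEv, sub_self]

variable [SymmetricCategory C]
  [∀ X : C, PreservesFiniteLimits (tensorLeft X)]
  [∀ X : C, PreservesFiniteColimits (tensorLeft X)]

/-- The morphism `A ⊗ Aᵛ ⟶ 1` induced by the evaluation of `A₁`. -/
def evaluation (A : Prolongation C) (hA : A.ext.DualExact) : tensorObj A (A.dual hA) ⟶ unit C :=
  toUnit _ (tensorMidDesc A (A.dual hA) (dualEv A.ext.mid) (balance_comp_dualEv A hA))

theorem tensorMid_evaluation (A : Prolongation C) (hA : A.ext.DualExact) :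
    tensorMid A (A.dual hA) ≫ (evaluation A hA).ext.mid ≫ biprod.fst = dualEv A.ext.mid := by
  rw [evaluation, toUnit, biprod.lift_fst, tensorMid_tensorMidDesc]

theorem evaluation_base (A : Prolongation C) (hA : A.ext.DualExact) :
    (evaluation A hA).base = dualEv A.base := by
  have : Epi (A.base ◁ (A.dual hA).ext.proj) := (tensorL A.base (A.ext.dual hA)).shortExact.epi_g
  rw [← cancel_epi (A.base ◁ (A.dual hA).ext.proj), evaluation, toUnit,
    reassoc_of% whiskerLeft_proj_comp_tensor_incl, tensorMid_tensorMidDesc]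
  exact (whiskerLeft_dualMap_comp_dualEv A.ext.incl).symm

theorem coev_comp_balance (h : IsRigid C) (A : Prolongation C) :
    h.coev A.ext.mid ≫ balance (A.dual (h.dualExact A.ext)) A = 0 := by
  rw [balance, Preadditive.comp_sub, ← dualMap_comp, h.coev_comp_whiskerLeft, sub_self]

/-- The morphism `1 ⟶ Aᵛ ⊗ A` induced by the coevaluation of `A₁`. -/
def coevaluation (h : IsRigid C) (A : Prolongation C) :
    unit C ⟶ tensorObj (A.dual (h.dualExact A.ext)) A :=
  ofUnit _ (normMidLift _ A (h.coev A.ext.mid) (coev_comp_balance h A))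

theorem coevaluation_base (h : IsRigid C) (A : Prolongation C) :
    (coevaluation h A).base = h.coev A.base := by
  rw [← cancel_mono ((A.dual (h.dualExact A.ext)).base ◁ A.ext.incl), coevaluation, ofUnit,
    Category.assoc, ← normMid_proj, reassoc_of% normMidLift_normMid]
  exact (h.coev_comp_whiskerLeft A.ext.incl).symm

attribute [local instance] monoidalCategory symmetricCategory braidedPi₀

theorem exists_exactPairing (h : IsRigid C) (A : Prolongation C) :
    ∃ p : ExactPairing (A.dual (h.dualExact A.ext)) A,
      p.evaluation' = evaluation A (h.dualExact A.ext) := by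
  refine exists_exactPairing_of_map (Pi₀ C) (A := A) (evaluation A (h.dualExact A.ext))
    (coevaluation h A) ?_ ?_
  · rw [μ_comp_Pi₀_map_comp_η, ε_comp_Pi₀_map_comp_δ, evaluation_base, coevaluation_base]
    exact h.zigzagLeft_eq A.base
  · rw [μ_comp_Pi₀_map_comp_η, ε_comp_Pi₀_map_comp_δ, evaluation_base, coevaluation_base]
    exact h.zigzagRight_eq A.base

/-- The closed structure on the prolongation of a rigid category, given by
`Hom(A, B) = Aᵛ ⊗ B`. -/
abbrev monoidalClosed (h : IsRigid C) : MonoidalClosed (Prolongation C) where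
  closed A :=
    haveI : HasLeftDual A :=
      { leftDual := A.dual (h.dualExact A.ext), exact := (exists_exactPairing h A).choose }
    closedOfHasLeftDual A

theorem isIso_ihomComparison (h : IsRigid C) (A B : Prolongation C) :
    letI := monoidalClosed h
    IsIso (ihomComparison (Pi₀ C) A B) := by
  let _ := monoidalClosed h
  have := h.isIso_dualTensor A.base B.base
  suffices ihomComparison (Pi₀ C) A B = dualTensor A.base B.base from this ▸ ‹_›
  have hev : (ihom.ev A).app B = A ◁ 𝟙 _ ≫ (α_ _ _ _).inv ≫
      (exists_exactPairing h A).choose.evaluation' ▷ B ≫ (λ_ B).hom := rfl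
  rw [ihomComparison, hev, whiskerLeft_id, Category.id_comp, (exists_exactPairing h A).choose_spec,
    dualTensor, ← tensorHom_id (dualEv A.base), ← evaluation_base A (h.dualExact A.ext)]
  exact congrArg curry (Category.id_comp _)

theorem isIso_curry_evaluation (h : IsRigid C) (A : Prolongation C) :
    letI := monoidalClosed h
    IsIso
      (curry (A := A) (Y := A.dual (h.dualExact A.ext)) (evaluation A (h.dualExact A.ext))) := by
  let _ := monoidalClosed h
  have := isIso_ihomComparison h A (unit C)
  have h_curry : curry (μ (Pi₀ C) A _ ≫ (Pi₀ C).map (evaluation A (h.dualExact A.ext))) =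
      𝟙 (dualObj A.base) :=
    (congrArg curry ((Category.id_comp _).trans (evaluation_base A _))).trans (curry_dualEv _)
  have : IsIso (curry (μ (Pi₀ C) A _ ≫ (Pi₀ C).map (evaluation A (h.dualExact A.ext)))) :=
    h_curry ▸ IsIso.id _
  exact isIso_curry_of_map (Pi₀ C) (evaluation A (h.dualExact A.ext))

end Prolongation

end

theorem mainTheorem9 {C : Type u} [Category.{v} C] [Abelian C] [MonoidalCategory C]
    [MonoidalPreadditive C] [SymmetricCategory C]
    [∀ X : C, PreservesFiniteLimits (tensorLeft X)]
    [∀ X : C, PreservesFiniteColimits (tensorLeft X)] :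
    ∃ hM : IsMonoidalStruct (D := Prolongation C) Prolongation.tensorStruct,
      letI : MonoidalCategory (Prolongation C) := hM.monoidalCategory
      ∃ _ : SymmetricCategory (Prolongation C),
        (∀ A B : Prolongation C, β_ A B = Prolongation.braiding A B) ∧
        (∃ _ : (Prolongation.Pi₀ C).Braided,
          Functor.LaxMonoidal.ε (Prolongation.Pi₀ C) = 𝟙 (𝟙_ C) ∧
          ∀ A B : Prolongation C,
            Functor.LaxMonoidal.μ (Prolongation.Pi₀ C) A B = 𝟙 (A.base ⊗ B.base)) ∧
        ∀ [MonoidalClosed C], IsRigid C →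
          ∃ _ : MonoidalClosed (Prolongation C), IsRigid (Prolongation C) ∧
            ∀ A : Prolongation C, ∃ (hA : A.ext.DualExact)
                (e : A ⊗ A.dual hA ⟶ 𝟙_ (Prolongation C)),
              e.base = dualEv A.base ∧
              Prolongation.tensorMid A (A.dual hA) ≫ e.ext.mid ≫ biprod.fst = dualEv A.ext.mid ∧
              IsIso (MonoidalClosed.curry e) := by
  refine ⟨⟨Prolongation.monoidalCategory C, rfl⟩, Prolongation.symmetricCategory C,
    fun A B => rfl, ⟨Prolongation.braidedPi₀ C, rfl, fun A B => rfl⟩, fun hC => ?_⟩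
  let _ := Prolongation.monoidalCategory C
  let _ := Prolongation.symmetricCategory C
  let _ := Prolongation.braidedPi₀ C
  let _ := Prolongation.monoidalClosed hC
  have h_rigid : IsRigid (Prolongation C) :=
    isRigid_of_isIso_ihomComparison (Prolongation.Pi₀ C) hC (Prolongation.isIso_ihomComparison hC)
  exact ⟨Prolongation.monoidalClosed hC, h_rigid, fun A =>
    ⟨hC.dualExact A.ext, Prolongation.evaluation A _, Prolongation.evaluation_base A _,
      Prolongation.tensorMid_evaluation A _, Prolongation.isIso_curry_evaluation hC A⟩⟩
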